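/- For $n\ge 1$ let $D\in\mathbb{C}^{n\times n}$ be the unitary DFT matrix, $D_{i,j}=n^{-1/2}e^{-2\pi \mathbf{i}(i-1)(j-1)/n}$. For $x\in\mathbb{C}^n$ let $S_1$ and $S_2$ be the sets of indices of the nonzero entries of $x$ and of $Dx$, respectively. A set $S\subseteq\{1,\dots,n\}$ is called $l$-periodic if $l$ divides $n$ and, for every $i$, one has $i\in S$ if and only if $j\in S$ for all $j\in\{1,\dots,n\}$ with $j\equiv i \pmod l$. Given $A\in\mathbb{C}^{m\times n}$ and $\lambda>0$, Joint Basis Pursuit (JBP) with parameter $\lambda$ is the problem $$\min_{\hat x\in\mathbb{C}^n}\ \|\hat x\|_1+\lambda\|D\hat x\|_1\quad\text{subject to}\quad A\hat x=Ax,$$ and it is said to recover $x$ if $x$ is its unique minimizer. **Theorem.** There is an absolute constant $C>0$ such that for every $\alpha\in[0,1)$ and every $\varepsilon>0$ there is an $N$ such that the following holds for all $n\ge N$. Let $n=n_1n_2$ with positive integers $n_1,n_2$, and let $x\in\mathbb{C}^n$ be a fixed vector such that $S_1$ is $n_1$-periodic, $S_2$ is $n_2$-periodic, and $$|S_1|\le|S_2|,\qquad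 |S_1|\le\frac{n}{\log n},\qquad |S_2|\le|S_1|(\log n)^{\alpha}.$$ Let $A\in\mathbb{C}^{m\times n}$ have i.i.d. centred circularly symmetric complex Gaussian entries of some positive variance. 1. If $|S_2|\le|S_1|\log\log n$ and $m\ge C|S_2|\log\log n$, then JBP with $\lambda=1$ recovers $x$ with probability at least $1-\varepsilon$. 2. If $|S_2|\ge|S_1|\log\log n$ and $m\ge C|S_2|$, then JBP with $\lambda=1/\log n$ recovers $x$ with probability at least $1-\varepsilon$. In particular, $m=O(|S_2|\log\log n)$, respectively $m=O(|S_2|)$, measurements suffice for recovery with high probability. -/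

import Mathlib

open scoped NNReal ENNReal

noncomputable section

namespace JBP

/-- The unitary DFT matrix, with rows and columns indexed from `0`. -/
def dft (n : ℕ) : Matrix (Fin n) (Fin n) ℂ := fun i j =>
  Complex.exp (-(2 * (Real.pi : ℂ) * Complex.I) / (n : ℂ)) ^ ((i : ℕ) * (j : ℕ)) /
    ((Real.sqrt (n : ℝ) : ℝ) : ℂ)

/-- The `ℓ₁` norm on `ℂⁿ`. -/
def l1Norm {n : ℕ} (v : Fin n → ℂ) : ℝ := ∑ i, ‖v i‖

/-- The support of `x` in the basis `U`: the locations of the nonzero entries of `U x`. -/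
def supp {n : ℕ} (U : Matrix (Fin n) (Fin n) ℂ) (x : Fin n → ℂ) : Finset (Fin n) :=
  Finset.univ.filter fun i => U.mulVec x i ≠ 0

/-- `S` is an `l`-periodic subset of the index set. Shifting the indices from `1, …, n` to
`0, …, n - 1` does not affect congruences. -/
def IsPeriodic {n : ℕ} (l : ℕ) (S : Finset (Fin n)) : Prop :=
  l ∣ n ∧ ∀ i : Fin n, i ∈ S ↔ ∀ j : Fin n, (j : ℕ) ≡ (i : ℕ) [MOD l] → j ∈ S

/-- The cost function of Joint Basis Pursuit. -/
def cost {n : ℕ} (U₁ U₂ : Matrix (Fin n) (Fin n) ℂ) (lam : ℝ) (x : Fin n → ℂ) : ℝ :=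
  l1Norm (U₁.mulVec x) + lam * l1Norm (U₂.mulVec x)

/-- Joint Basis Pursuit recovers `x` from `A x`: among all `y` with `A y = A x`, the vector `x`
is the unique minimizer of the cost. -/
def Recovers {m n : ℕ} (U₁ U₂ : Matrix (Fin n) (Fin n) ℂ) (lam : ℝ)
    (A : Matrix (Fin m) (Fin n) ℂ) (x : Fin n → ℂ) : Prop :=
  ∀ y : Fin n → ℂ, A.mulVec y = A.mulVec x → y ≠ x → cost U₁ U₂ lam x < cost U₁ U₂ lam y

/-- The centred circular complex Gaussian law of variance `v`: real and imaginary parts are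
independent real Gaussians of variance `v / 2`. -/
def complexGaussian (v : ℝ≥0) : MeasureTheory.Measure ℂ :=
  ((ProbabilityTheory.gaussianReal 0 (v / 2)).prod
    (ProbabilityTheory.gaussianReal 0 (v / 2))).map fun p : ℝ × ℝ => (⟨p.1, p.2⟩ : ℂ)

/-- The law of an `m × n` matrix with i.i.d. complex Gaussian entries of variance `v`. -/
def gaussianMatrix (m n : ℕ) (v : ℝ≥0) : MeasureTheory.Measure (Fin m → Fin n → ℂ) :=
  MeasureTheory.Measure.pi fun _ : Fin m =>
    MeasureTheory.Measure.pi fun _ : Fin n => complexGaussian v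

end JBP

end

/-!
If recovery of `x` fails, normalizing the difference of a competing minimizer and `x` gives a unit
vector `h` in the kernel of `A` with `‖h‖₁ + lam ‖U h‖₁ ≤ R := 2 (√s₁ + lam √s₂)`, where `s₁` and
`s₂` are the support sizes. Whether `A` has such a kernel vector is decided by the width of the
set of these `h`, the mean of `sup Re ⟨g, h⟩` for a Gaussian row `g`.

To bound the width, clip `g` at level `t = √(8 log log n)`. The clipped part has sup norm `O(t)`
and is paired with `h`. The remainder is sparse; in the basis `U`, all of whose entries are small,
its sup norm has mean `O(1 / log n)`, so it is paired with `U h`, and `lam ≥ 1 / log n` gives a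
width of `O(R √(log log n))`.

For the escape estimate, `h ∈ ker A` forces every `min |Re ⟨aₖ, h⟩| 1` to vanish, while their mean
is a positive constant. Symmetrization and contraction bound the mean of the largest deviation by
`2 √m` times the width, the Efron–Stein inequality bounds its variance by `m`, and Chebyshev's
inequality gives failure probability `O(1 / m)` once `m ≥ C R² log log n`. Finally, the
uncertainty principle `‖h‖² ≤ n ^ (-1/2) ‖h‖₁ ‖U h‖₁` makes `R²`, hence `m`, tend to infinity
whenever such an `h` exists.
-/

noncomputable section

namespace JBP

open MeasureTheory ProbabilityTheory Matrix

section FiniteSup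

variable {ι Ω : Type*} [Finite ι] [Nonempty ι] [MeasurableSpace Ω] {μ : Measure Ω}

lemma abs_iSup_le_sum_abs {ι : Type*} [Fintype ι] [Nonempty ι] (f : ι → ℝ) :
    |⨆ i, f i| ≤ ∑ i, |f i| := by
  obtain ⟨i, hi⟩ := exists_eq_ciSup_of_finite (f := f)
  rw [← hi]
  exact Finset.single_le_sum (f := fun j => |f j|) (fun j _ => abs_nonneg _) (Finset.mem_univ i)

lemma integrable_iSup {f : ι → Ω → ℝ} (hf : ∀ i, Integrable (f i) μ)
    (hm : ∀ i, Measurable (f i)) : Integrable (fun x => ⨆ i, f i x) μ := by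
  cases nonempty_fintype ι
  refine Integrable.mono' (integrable_finsetSum Finset.univ fun i _ => (hf i).abs)
    (Measurable.iSup hm).aestronglyMeasurable (.of_forall fun x => ?_)
  simpa using abs_iSup_le_sum_abs fun i => f i x

lemma integrable_iSup_const_add [IsFiniteMeasure μ] {f : ι → Ω → ℝ}
    (hf : ∀ i, Integrable (f i) μ) (hm : ∀ i, Measurable (f i)) (A : ι → ℝ) :
    Integrable (fun x => ⨆ i, (A i + f i x)) μ :=
  integrable_iSup (fun i => integrable_const_add_iff.2 (hf i)) fun i => (hm i).const_add _

lemma iSup_add_iSup_le_of_lipschitzWith {φ : ℝ → ℝ} {K : ℝ≥0} (hφ : LipschitzWith K φ)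
    (A u : ι → ℝ) :
    (⨆ i, (A i + φ (u i))) + ⨆ i, (A i - φ (u i)) ≤
      (⨆ i, (A i + K * u i)) + ⨆ i, (A i - K * u i) := by
  obtain ⟨i, hi⟩ := exists_eq_ciSup_of_finite (f := fun i => A i + φ (u i))
  obtain ⟨j, hj⟩ := exists_eq_ciSup_of_finite (f := fun i => A i - φ (u i))
  have hlip : φ (u i) - φ (u j) ≤ |K * u i - K * u j| := by
    rw [← mul_sub, abs_mul, NNReal.abs_eq]
    exact (le_abs_self _).trans (by simpa [Real.dist_eq] using hφ.dist_le_mul (u i) (u j))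
  have hplus k := le_ciSup (Set.finite_range fun i => A i + K * u i).bddAbove k
  have hminus k := le_ciSup (Set.finite_range fun i => A i - K * u i).bddAbove k
  rcases abs_cases (K * u i - K * u j) with h | h
  · linarith [hplus i, hminus j]
  · linarith [hplus j, hminus i]

lemma integral_iSup_integral_sub_le [IsProbabilityMeasure μ] {f : ι → Ω → ℝ}
    (hf : ∀ i, Integrable (f i) μ) (hm : ∀ i, Measurable (f i)) (A : ι → ℝ) :
    ∫ x, ⨆ i, (A i + ((∫ y, f i y ∂μ) - f i x)) ∂μ ≤
      (1 / 2) * ((∫ x, ⨆ i, (A i + 2 * f i x) ∂μ) + ∫ x, ⨆ i, (A i + -2 * f i x) ∂μ) := by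
  have h_int (c : ℝ) : Integrable (fun x => ⨆ i, (A i + c * f i x)) μ :=
    integrable_iSup_const_add (fun i => (hf i).const_mul c) (fun i => by fun_prop) A
  have hcentred : Integrable (fun x => ⨆ i, (A i + ((∫ y, f i y ∂μ) - f i x))) μ :=
    integrable_iSup_const_add (fun i => (integrable_const _).sub (hf i)) (fun i => by fun_prop) A
  have hmean i : A i + 2 * ∫ y, f i y ∂μ ≤ ∫ y, ⨆ i, (A i + 2 * f i y) ∂μ := by
    have h := integral_mono ((integrable_const (A i)).add ((hf i).const_mul 2)) (h_int 2)
      fun y => le_ciSup (Set.finite_range fun i => A i + 2 * f i y).bddAbove i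
    simpa [integral_add (integrable_const _) ((hf i).const_mul 2), integral_const_mul] using h
  have hpoint x : ⨆ i, (A i + ((∫ y, f i y ∂μ) - f i x)) ≤
      (1 / 2) * ((∫ y, ⨆ i, (A i + 2 * f i y) ∂μ) + ⨆ i, (A i + -2 * f i x)) :=
    ciSup_le fun i => by
      linarith [hmean i, le_ciSup (Set.finite_range fun i => A i + -2 * f i x).bddAbove i]
  refine (integral_mono hcentred ((integrable_const_add_iff.2 (h_int (-2))).const_mul _)
    hpoint).trans_eq ?_
  rw [integral_const_mul, integral_add (integrable_const _) (h_int (-2))]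
  simp

end FiniteSup

section Contraction

variable {ι E : Type*} [NormedAddCommGroup E] [NormedSpace ℝ E]
  [MeasurableSpace E] [BorelSpace E] {μ : Measure E} [IsGaussian μ] {φ : ℝ → ℝ} {K : ℝ≥0}

lemma integrable_lipschitzWith_comp_dual (hφ : LipschitzWith K φ) (L : StrongDual ℝ E) :
    Integrable (fun x => φ (L x)) μ := by
  have h : LipschitzWith K fun s => φ s - φ 0 := by
    simpa using hφ.sub (LipschitzWith.const (φ 0))
  have h_int := memLp_one_iff_integrable.1
    (h.comp_memLp (sub_self _) (IsGaussian.memLp_dual μ L 1 (by simp)))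
  simpa [Function.comp_def] using (integrable_add_const_iff (c := φ 0)).2 h_int

variable [SecondCountableTopology E] [CompleteSpace E]

lemma measurePreserving_smul_add_smul (hμ : ∫ x, x ∂μ = 0) {a b : ℝ} (hab : a ^ 2 + b ^ 2 = 1) :
    MeasurePreserving (fun p : E × E => a • p.1 + b • p.2) (μ.prod μ) μ := by
  have hnorm : ‖(⟨a, b⟩ : ℂ)‖ = 1 := by
    rw [← sq_eq_sq₀ (norm_nonneg _) zero_le_one, ← Complex.normSq_eq_norm_sq,
      Complex.normSq_mk, one_pow, ← hab]
    ring
  have hcos := Complex.norm_mul_cos_arg ⟨a, b⟩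
  have hsin := Complex.norm_mul_sin_arg ⟨a, b⟩
  rw [hnorm, one_mul] at hcos hsin
  have h := congrArg (Measure.map Prod.fst)
    (IsGaussian.map_rotation_eq_self (μ := μ) hμ (Complex.arg ⟨a, b⟩))
  rw [Measure.map_map (by fun_prop) (by fun_prop)] at h
  refine ⟨by fun_prop, ?_⟩
  simpa [Function.comp_def, ContinuousLinearMap.rotation_apply, hcos, hsin] using h

lemma measurePreserving_neg_of_isGaussian (hμ : ∫ x, x ∂μ = 0) :
    MeasurePreserving (fun x : E => -x) μ μ := by
  refine ⟨by fun_prop, ?_⟩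
  have h := (measurePreserving_smul_add_smul hμ (a := -1) (b := 0) (by norm_num)).map_eq
  rw [show (fun p : E × E => (-1 : ℝ) • p.1 + (0 : ℝ) • p.2) = (fun x => -x) ∘ Prod.fst by
    ext p; simp, ← Measure.map_map (by fun_prop) (by fun_prop)] at h
  simpa using h

variable [Finite ι]

lemma integral_iSup_add_dual_prod (hμ : ∫ x, x ∂μ = 0) (A : ι → ℝ) (u : ι → StrongDual ℝ E)
    (a b : ℝ) :
    ∫ p, ⨆ i, (A i + (a * u i p.1 + b * u i p.2)) ∂(μ.prod μ) =
      ∫ x, ⨆ i, (A i + √(a ^ 2 + b ^ 2) * u i x) ∂μ := by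
  rcases (by positivity : 0 ≤ a ^ 2 + b ^ 2).eq_or_lt with h0 | hpos
  · obtain rfl : a = 0 := by nlinarith
    obtain rfl : b = 0 := by nlinarith
    simp
  have hs : √(a ^ 2 + b ^ 2) ≠ 0 := (Real.sqrt_pos.2 hpos).ne'
  have hrot := measurePreserving_smul_add_smul hμ (a := a / √(a ^ 2 + b ^ 2))
    (b := b / √(a ^ 2 + b ^ 2)) (by
      rw [div_pow, div_pow, Real.sq_sqrt hpos.le, ← add_div, div_self hpos.ne'])
  have hmeas : Measurable fun x => ⨆ i, (A i + √(a ^ 2 + b ^ 2) * u i x) :=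
    Measurable.iSup fun i => by fun_prop
  have hmap := integral_map hrot.aemeasurable hmeas.aestronglyMeasurable (μ := μ.prod μ)
  rw [hrot.map_eq] at hmap
  rw [hmap]
  refine integral_congr_ae (.of_forall fun p => ?_)
  dsimp only
  refine iSup_congr fun i => ?_
  simp only [map_add, map_smul, smul_eq_mul]
  field_simp

variable [Nonempty ι]

lemma integral_iSup_sub_lipschitzWith_le (hμ : ∫ x, x ∂μ = 0) (hφ : LipschitzWith K φ)
    (A : ι → ℝ) (u : ι → StrongDual ℝ E) :
    ∫ x, ⨆ i, (A i + ((∫ y, φ (u i y) ∂μ) - φ (u i x))) ∂μ ≤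
      ∫ x, ⨆ i, (A i + 2 * K * u i x) ∂μ := by
  have hφm : Measurable φ := hφ.continuous.measurable
  have hφi i := integrable_lipschitzWith_comp_dual (μ := μ) hφ (u i)
  have hφ2 : LipschitzWith (2 * K) fun s => 2 * φ s := by
    simpa [Function.comp_def] using (lipschitzWith_smul (2 : ℝ)).comp hφ
  have h_int (c : ℝ) : Integrable (fun x => ⨆ i, (A i + c * u i x)) μ :=
    integrable_iSup_const_add (fun i => (IsGaussian.integrable_dual μ (u i)).const_mul c)
      (fun i => by fun_prop) A
  have hφint (c : ℝ) : Integrable (fun x => ⨆ i, (A i + c * φ (u i x))) μ :=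
    integrable_iSup_const_add (fun i => (hφi i).const_mul c) (fun i => by fun_prop) A
  have hneg : ∫ x, ⨆ i, (A i + -(2 * K) * u i x) ∂μ = ∫ x, ⨆ i, (A i + 2 * K * u i x) ∂μ := by
    rw [← (measurePreserving_neg_of_isGaussian hμ).integral_comp
      (MeasurableEquiv.neg E).measurableEmbedding]
    simp
  have htwoPoint : (∫ x, ⨆ i, (A i + 2 * φ (u i x)) ∂μ) + ∫ x, ⨆ i, (A i + -2 * φ (u i x)) ∂μ ≤
      (∫ x, ⨆ i, (A i + 2 * K * u i x) ∂μ) + ∫ x, ⨆ i, (A i + -(2 * K) * u i x) ∂μ := by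
    rw [← integral_add (hφint _) (hφint _), ← integral_add (h_int _) (h_int _)]
    refine integral_mono ((hφint _).add (hφint _)) ((h_int _).add (h_int _)) fun x => ?_
    simpa [sub_eq_add_neg] using iSup_add_iSup_le_of_lipschitzWith hφ2 A fun i => u i x
  linarith [integral_iSup_integral_sub_le hφi (fun i => by fun_prop) A]

lemma integral_pi_succ {X : Type*} [MeasurableSpace X] (ρ : Measure X) [SigmaFinite ρ] (m : ℕ)
    (F : (Fin (m + 1) → X) → ℝ) :
    ∫ x, F x ∂(Measure.pi fun _ : Fin (m + 1) => ρ) =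
      ∫ p, F (Fin.cons p.1 p.2) ∂(ρ.prod (Measure.pi fun _ : Fin m => ρ)) := by
  rw [← (measurePreserving_piFinSuccAbove (fun _ : Fin (m + 1) => ρ) 0).symm.integral_comp']
  simp [MeasurableEquiv.piFinSuccAbove_symm_apply, Fin.insertNthEquiv]

/-- The copies are contracted one at a time, and rotation invariance merges the resulting Gaussian
linear terms into one. -/
lemma integral_iSup_sum_sub_lipschitzWith_le (hμ : ∫ x, x ∂μ = 0) (hφ : LipschitzWith K φ)
    (u : ι → StrongDual ℝ E) (m : ℕ) (A : ι → ℝ) :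
    ∫ x, ⨆ i, (A i + ∑ k, ((∫ y, φ (u i y) ∂μ) - φ (u i (x k)))) ∂(Measure.pi fun _ : Fin m => μ)
      ≤ ∫ x, ⨆ i, (A i + 2 * K * √m * u i x) ∂μ := by
  induction m generalizing A with
  | zero => simp
  | succ m ih =>
    have hφm : Measurable φ := hφ.continuous.measurable
    have hui i := IsGaussian.integrable_dual μ (u i)
    set ψ : ι → E → ℝ := fun i x => (∫ y, φ (u i y) ∂μ) - φ (u i x)
    have hψi i : Integrable (ψ i) μ :=
      (integrable_const _).sub (integrable_lipschitzWith_comp_dual hφ (u i))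
    have hψm i : Measurable (ψ i) := by fun_prop
    have hsum : Integrable (fun p : E × (Fin m → E) => ⨆ i, (A i + ψ i p.1 + ∑ k, ψ i (p.2 k)))
        (μ.prod (Measure.pi fun _ : Fin m => μ)) := by
      refine integrable_iSup (fun i => .add (integrable_const_add_iff.2 ((hψi i).comp_fst _))
        (integrable_finsetSum _ fun k _ => ?_)) (fun i => by fun_prop)
      exact ((measurePreserving_eval (fun _ : Fin m => μ) k).integrable_comp_of_integrable
        (hψi i)).comp_snd μ
    have hmixed : Integrable (fun p : E × E => ⨆ i, (A i + ψ i p.1 + 2 * K * √m * u i p.2))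
        (μ.prod μ) :=
      integrable_iSup (fun i => .add (integrable_const_add_iff.2 ((hψi i).comp_fst μ))
        (((hui i).comp_snd μ).const_mul _)) (fun i => by fun_prop)
    have hlin : Integrable (fun p : E × E => ⨆ i, (A i + 2 * K * √m * u i p.2 + 2 * K * u i p.1))
        (μ.prod μ) :=
      integrable_iSup (fun i => .add (integrable_const_add_iff.2 (((hui i).comp_snd μ).const_mul _))
        (((hui i).comp_fst μ).const_mul _)) (fun i => by fun_prop)
    calc _ = ∫ x, ∫ y, ⨆ i, (A i + ψ i x + ∑ k, ψ i (y k)) ∂(Measure.pi fun _ : Fin m => μ) ∂μ := by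
          simp only [integral_pi_succ, Fin.sum_univ_succ, Fin.cons_zero, Fin.cons_succ, ← add_assoc]
          exact integral_prod _ hsum
      _ ≤ ∫ x, ∫ y, ⨆ i, (A i + ψ i x + 2 * K * √m * u i y) ∂μ ∂μ :=
          integral_mono hsum.integral_prod_left hmixed.integral_prod_left
            fun x => ih fun i => A i + ψ i x
      _ = ∫ y, ∫ x, ⨆ i, (A i + 2 * K * √m * u i y + ψ i x) ∂μ ∂μ := by
          rw [integral_integral_swap hmixed]
          simp only [add_right_comm]
      _ ≤ ∫ y, ∫ x, ⨆ i, (A i + 2 * K * √m * u i y + 2 * K * u i x) ∂μ ∂μ := by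
          refine integral_mono ?_ hlin.integral_prod_right fun y =>
            integral_iSup_sub_lipschitzWith_le hμ hφ _ u
          simpa only [add_right_comm] using hmixed.integral_prod_right
      _ = ∫ p, ⨆ i, (A i + (2 * K * u i p.1 + 2 * K * √m * u i p.2)) ∂(μ.prod μ) := by
          rw [← integral_prod_symm _ hlin]
          simp only [add_assoc, add_comm (2 * (K : ℝ) * _)]
      _ = _ := by
          rw [integral_iSup_add_dual_prod hμ, mul_pow _ √m, Real.sq_sqrt m.cast_nonneg,
            show (2 * K : ℝ) ^ 2 + (2 * K) ^ 2 * m = (2 * K) ^ 2 * (m + 1 : ℕ) by push_cast; ring,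
            Real.sqrt_mul (by positivity), Real.sqrt_sq (by positivity)]

end Contraction

section EfronStein

lemma variance_prod {X Y : Type*} [MeasurableSpace X] [MeasurableSpace Y] {μ : Measure X}
    {ν : Measure Y} [IsProbabilityMeasure μ] [IsProbabilityMeasure ν] {F : X × Y → ℝ}
    (hF : MemLp F 2 (μ.prod ν)) :
    Var[F; μ.prod ν] = ∫ y, Var[fun x => F (x, y); μ] ∂ν + Var[fun y => ∫ x, F (x, y) ∂μ; ν] := by
  have hF1 := hF.integrable one_le_two
  have hF2 := hF.integrable_sq
  have hsection : ∀ᵐ y ∂ν, MemLp (fun x => F (x, y)) 2 μ := by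
    filter_upwards [hF1.prod_left_ae, hF2.prod_left_ae] with y h1 h2
    exact (memLp_two_iff_integrable_sq h1.aestronglyMeasurable).2 h2
  have hvar : ∀ᵐ y ∂ν, Var[fun x => F (x, y); μ] =
      (∫ x, F (x, y) ^ 2 ∂μ) - (∫ x, F (x, y) ∂μ) ^ 2 := by
    filter_upwards [hsection] with y hy using variance_eq_sub hy
  have hmean : MemLp (fun y => ∫ x, F (x, y) ∂μ) 2 ν := by
    have hmeas := hF1.integral_prod_right.aestronglyMeasurable
    refine (memLp_two_iff_integrable_sq hmeas).2 <|
      hF2.integral_prod_right.mono' (hmeas.pow 2) ?_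
    filter_upwards [hvar] with y hy
    rw [Real.norm_of_nonneg (sq_nonneg _)]
    linarith [variance_nonneg (fun x => F (x, y)) μ]
  rw [integral_congr_ae hvar, integral_sub hF2.integral_prod_right hmean.integrable_sq,
    variance_eq_sub hF, variance_eq_sub hmean]
  simp only [Pi.pow_apply, integral_prod_symm _ hF1, integral_prod_symm _ hF2]
  ring

lemma variance_le_sq_of_abs_sub_le {Ω : Type*} [MeasurableSpace Ω] {μ : Measure Ω}
    [IsProbabilityMeasure μ] {X : Ω → ℝ} (hX : AEMeasurable X μ) {c : ℝ}
    (h : ∀ ω ω', |X ω - X ω'| ≤ c) : Var[X; μ] ≤ c ^ 2 := by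
  obtain ⟨ω₀⟩ := nonempty_of_isProbabilityMeasure μ
  refine (variance_le_sq_of_bounded (a := X ω₀ - c) (b := X ω₀ + c) (.of_forall fun ω => ?_)
    hX).trans_eq (by ring)
  have := abs_le.1 (h ω ω₀)
  constructor <;> linarith

lemma abs_integral_sub_integral_le {Ω : Type*} [MeasurableSpace Ω] {μ : Measure Ω}
    [IsProbabilityMeasure μ] {f g : Ω → ℝ} (hf : Integrable f μ) (hg : Integrable g μ) {c : ℝ}
    (h : ∀ ω, |f ω - g ω| ≤ c) : |∫ ω, f ω ∂μ - ∫ ω, g ω ∂μ| ≤ c := by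
  rw [← integral_sub hf hg]
  simpa using norm_integral_le_of_norm_le_const (μ := μ) (f := fun ω => f ω - g ω) (.of_forall h)

lemma abs_sub_le_sum_of_bounded_differences {X : Type*} {m : ℕ} {f : (Fin m → X) → ℝ}
    {c : Fin m → ℝ} (hd : ∀ x k y, |f x - f (Function.update x k y)| ≤ c k) (x y : Fin m → X) :
    |f x - f y| ≤ ∑ k, c k := by
  induction m with
  | zero => simp [Subsingleton.elim x y]
  | succ m ih =>
    have htail := ih (f := fun r => f (Fin.cons (x 0) r)) (c := fun k => c k.succ) (fun r k z => by
      simpa only [← Fin.cons_update] using hd (Fin.cons (x 0) r) k.succ z) (Fin.tail x) (Fin.tail y)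
    have hhead := hd (Fin.cons (x 0) (Fin.tail y)) 0 (y 0)
    rw [Fin.update_cons_zero, Fin.cons_self_tail] at hhead
    rw [Fin.cons_self_tail] at htail
    rw [Fin.sum_univ_succ, add_comm]
    exact (abs_sub_le _ _ _).trans (add_le_add htail hhead)

lemma exists_abs_le_of_bounded_differences {X : Type*} {m : ℕ} {f : (Fin m → X) → ℝ}
    {c : Fin m → ℝ} (hd : ∀ x k y, |f x - f (Function.update x k y)| ≤ c k) :
    ∃ B, ∀ x, |f x| ≤ B := by
  rcases isEmpty_or_nonempty (Fin m → X) with h | ⟨⟨x₀⟩⟩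
  · exact ⟨0, h.elim⟩
  · refine ⟨|f x₀| + ∑ k, c k, fun x => ?_⟩
    linarith [abs_sub_abs_le_abs_sub (f x) (f x₀), abs_sub_le_sum_of_bounded_differences hd x x₀]

lemma variance_pi_le_sum_sq {X : Type*} [MeasurableSpace X] {μ : Measure X}
    [IsProbabilityMeasure μ] {m : ℕ} {f : (Fin m → X) → ℝ} (hf : Measurable f) {c : Fin m → ℝ}
    (hd : ∀ x k y, |f x - f (Function.update x k y)| ≤ c k) :
    Var[f; Measure.pi fun _ : Fin m => μ] ≤ ∑ k, c k ^ 2 := by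
  induction m with
  | zero => simp [variance_eq_integral hf.aemeasurable, Subsingleton.elim _ (default : Fin 0 → X)]
  | succ m ih =>
    obtain ⟨B, hB⟩ := exists_abs_le_of_bounded_differences hd
    set ν := Measure.pi fun _ : Fin m => μ
    have hmp := (measurePreserving_piFinSuccAbove (fun _ : Fin (m + 1) => μ) 0).symm
    set F : X × (Fin m → X) → ℝ := fun p => f (Fin.cons p.1 p.2)
    have hFe : F = f ∘ (MeasurableEquiv.piFinSuccAbove (fun _ : Fin (m + 1) => X) 0).symm := by
      ext p
      simp [F, MeasurableEquiv.piFinSuccAbove_symm_apply, Fin.insertNthEquiv]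
    have hFm : Measurable F := hFe ▸ hf.comp (MeasurableEquiv.measurable _)
    have hslice (r : Fin m → X) : Measurable fun a => F (a, r) := hFm.comp measurable_prodMk_right
    have hsection (r : Fin m → X) : Integrable (fun a => F (a, r)) μ :=
      .of_bound (hslice r).aestronglyMeasurable _ (.of_forall fun a => hB (Fin.cons a r))
    have hhead (r : Fin m → X) : Var[fun a => F (a, r); μ] ≤ c 0 ^ 2 :=
      variance_le_sq_of_abs_sub_le (hslice r).aemeasurable fun a b => by
        simpa only [Fin.update_cons_zero] using hd (Fin.cons a r) 0 b
    have htail : Var[fun r => ∫ a, F (a, r) ∂μ; ν] ≤ ∑ k : Fin m, c k.succ ^ 2 := by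
      refine ih (StronglyMeasurable.integral_prod_left hFm.stronglyMeasurable).measurable
        fun r k y => abs_integral_sub_integral_le (hsection _) (hsection _) fun a => ?_
      simpa only [← Fin.cons_update] using hd (Fin.cons a r) k.succ y
    rw [← hmp.map_eq, variance_map_equiv, ← hFe, variance_prod
      (.of_bound hFm.aestronglyMeasurable _ (.of_forall fun p => hB (Fin.cons p.1 p.2))),
      Fin.sum_univ_succ]
    refine add_le_add ?_ htail
    simpa using integral_mono_of_nonneg (μ := ν) (.of_forall fun r => variance_nonneg _ _)
      (integrable_const (c 0 ^ 2)) (.of_forall hhead)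

end EfronStein

/-- The truncation `min |s| 1` of the absolute value: a `1`-Lipschitz function with values in
`[0, 1]`, so that sums of it both contract and have bounded differences. -/
def truncAbs (s : ℝ) : ℝ := min |s| 1

lemma lipschitzWith_truncAbs : LipschitzWith 1 truncAbs :=
  lipschitzWith_one_norm.min_const 1

lemma continuous_truncAbs : Continuous truncAbs := lipschitzWith_truncAbs.continuous

lemma truncAbs_nonneg (s : ℝ) : 0 ≤ truncAbs s := le_min (abs_nonneg _) zero_le_one

lemma truncAbs_le_one (s : ℝ) : truncAbs s ≤ 1 := min_le_right _ _

/-- The mean of `truncAbs` under the standard real Gaussian, the constant governing the escape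
estimates. -/
def truncAbsMean : ℝ := ∫ s, truncAbs s ∂(gaussianReal 0 1)

lemma truncAbsMean_pos : 0 < truncAbsMean := by
  have h_int : Integrable truncAbs (gaussianReal 0 1) :=
    .of_bound continuous_truncAbs.aestronglyMeasurable 1 <| .of_forall fun s => by
      rw [Real.norm_of_nonneg (truncAbs_nonneg s)]
      exact truncAbs_le_one s
  have hsupport : Function.support truncAbs = {0}ᶜ := by
    ext s
    have := abs_nonneg s
    simp only [Function.mem_support, Set.mem_compl_iff, Set.mem_singleton_iff, truncAbs, ne_eq,
      min_eq_iff, abs_eq_zero, one_ne_zero, false_and, or_false, not_and, not_le]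
    grind
  have := nullSingletonClass_gaussianReal (μ := 0) (v := 1) one_ne_zero
  rw [truncAbsMean, integral_pos_iff_support_of_nonneg truncAbs_nonneg h_int, hsupport,
    prob_compl_eq_one_sub (measurableSet_singleton _), measure_singleton]
  simp

section Escape

lemma abs_iSup_sub_iSup_le {ι : Type*} [Finite ι] [Nonempty ι] {f g : ι → ℝ} {c : ℝ}
    (h : ∀ i, |f i - g i| ≤ c) : |(⨆ i, f i) - ⨆ i, g i| ≤ c := by
  have hf := le_ciSup (Set.finite_range f).bddAbove
  have hg := le_ciSup (Set.finite_range g).bddAbove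
  refine abs_sub_le_iff.2 ⟨sub_le_iff_le_add.2 (ciSup_le fun i => ?_),
    sub_le_iff_le_add.2 (ciSup_le fun i => ?_)⟩
  · linarith [hg i, (abs_sub_le_iff.1 (h i)).1]
  · linarith [hf i, (abs_sub_le_iff.1 (h i)).2]

lemma abs_iSup_sum_sub_iSup_sum_update_le {ι X : Type*} [Finite ι] [Nonempty ι] {m : ℕ}
    {g : ι → X → ℝ} {c : ℝ} (hg : ∀ i a b, |g i a - g i b| ≤ c) (x : Fin m → X) (k : Fin m)
    (y : X) : |(⨆ i, ∑ j, g i (x j)) - ⨆ i, ∑ j, g i (Function.update x k y j)| ≤ c := by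
  refine abs_iSup_sub_iSup_le fun i => ?_
  rw [← Finset.sum_sub_distrib, Finset.sum_eq_single_of_mem k (Finset.mem_univ k)
    fun j _ hj => by rw [Function.update_of_ne hj, sub_self], Function.update_self]
  exact hg i _ _

variable {E : Type*} [NormedAddCommGroup E] [NormedSpace ℝ E] [MeasurableSpace E] [BorelSpace E]
  [SecondCountableTopology E] [CompleteSpace E] {μ : Measure E} [IsGaussian μ]

lemma integral_truncAbs_dual (hμ : ∫ x, x ∂μ = 0) {L : StrongDual ℝ E} (hL : Var[L; μ] = 1) :
    ∫ x, truncAbs (L x) ∂μ = truncAbsMean := by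
  have h := IsGaussian.map_eq_gaussianReal (μ := μ) L
  rw [hL, IsGaussian.integral_dual, hμ, map_zero, Real.toNNReal_one] at h
  rw [truncAbsMean, ← h, integral_map (by fun_prop) continuous_truncAbs.aestronglyMeasurable]

variable {m : ℕ} {W : E → ℝ}

section Finite

variable {ι : Type*} [Finite ι] [Nonempty ι] {u : ι → StrongDual ℝ E}

lemma integral_iSup_sum_truncAbsMean_sub_le (hμ : ∫ x, x ∂μ = 0) (hu : ∀ i, Var[u i; μ] = 1)
    (hW : Integrable W μ) (huW : ∀ i x, u i x ≤ W x) :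
    ∫ x, ⨆ i, ∑ k, (truncAbsMean - truncAbs (u i (x k))) ∂(Measure.pi fun _ : Fin m => μ) ≤
      2 * √m * ∫ x, W x ∂μ := by
  have h := integral_iSup_sum_sub_lipschitzWith_le hμ lipschitzWith_truncAbs u m 0
  simp only [integral_truncAbs_dual hμ (hu _), Pi.zero_apply, zero_add, NNReal.coe_one,
    mul_one] at h
  refine h.trans ?_
  rw [← integral_const_mul]
  refine integral_mono (integrable_iSup
    (fun i => (IsGaussian.integrable_dual μ (u i)).const_mul _) fun i => by fun_prop)
    (hW.const_mul _) fun x => ciSup_le fun i => ?_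
  exact mul_le_mul_of_nonneg_left (huW i x) (by positivity)

/-- The supremum of the defects `∑ k, (truncAbsMean - truncAbs (u i (x k)))` has variance at most
`m` and mean at most `m * truncAbsMean / 4`, so Chebyshev's inequality applies. -/
lemma measure_exists_sum_truncAbs_le (hμ : ∫ x, x ∂μ = 0) (hu : ∀ i, Var[u i; μ] = 1)
    (hW : Integrable W μ) (huW : ∀ i x, u i x ≤ W x) (hm0 : 0 < m)
    (hm : 64 * (∫ x, W x ∂μ) ^ 2 ≤ truncAbsMean ^ 2 * m) :
    (Measure.pi fun _ : Fin m => μ) {x | ∃ i, ∑ k, truncAbs (u i (x k)) ≤ m * truncAbsMean / 4} ≤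
      ENNReal.ofReal (4 / (m * truncAbsMean ^ 2)) := by
  have hc := truncAbsMean_pos
  have hφm : Measurable truncAbs := continuous_truncAbs.measurable
  set P := Measure.pi fun _ : Fin m => μ
  set Z : (Fin m → E) → ℝ := fun x => ⨆ i, ∑ k, (truncAbsMean - truncAbs (u i (x k)))
  have hZm : Measurable Z := Measurable.iSup fun i => by fun_prop
  have hdiff (x : Fin m → E) (k : Fin m) (y : E) : |Z x - Z (Function.update x k y)| ≤ 1 := by
    refine abs_iSup_sum_sub_iSup_sum_update_le
      (g := fun i z => truncAbsMean - truncAbs (u i z)) (fun i a b => ?_) x k y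
    have := truncAbs_nonneg (u i a)
    have := truncAbs_nonneg (u i b)
    have := truncAbs_le_one (u i a)
    have := truncAbs_le_one (u i b)
    exact abs_sub_le_iff.2 ⟨by linarith, by linarith⟩
  have hvar : Var[Z; P] ≤ m := by simpa using variance_pi_le_sum_sq hZm hdiff
  have hZ2 : MemLp Z 2 P := by
    obtain ⟨B, hB⟩ := exists_abs_le_of_bounded_differences hdiff
    exact .of_bound hZm.aestronglyMeasurable B (.of_forall hB)
  have hmean : ∫ x, Z x ∂P ≤ m * truncAbsMean / 4 := by
    refine (integral_iSup_sum_truncAbsMean_sub_le hμ hu hW huW).trans ?_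
    have h8 : 8 * ∫ x, W x ∂μ ≤ truncAbsMean * √m := by
      refine le_of_sq_le_sq ?_ (by positivity)
      rw [mul_pow, mul_pow, Real.sq_sqrt m.cast_nonneg]
      linarith
    nlinarith [Real.sqrt_nonneg (m : ℝ), Real.mul_self_sqrt (m.cast_nonneg (α := ℝ))]
  have hsub : {x : Fin m → E | ∃ i, ∑ k, truncAbs (u i (x k)) ≤ m * truncAbsMean / 4} ⊆
      {x | m * truncAbsMean / 2 ≤ |Z x - ∫ x, Z x ∂P|} := by
    rintro x ⟨i, hi⟩
    have hsup : m * truncAbsMean - ∑ k, truncAbs (u i (x k)) ≤ Z x := by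
      simpa [Z] using le_ciSup
        (Set.finite_range fun i => ∑ k, (truncAbsMean - truncAbs (u i (x k)))).bddAbove i
    exact le_trans (by linarith : m * truncAbsMean / 2 ≤ Z x - ∫ x, Z x ∂P) (le_abs_self _)
  refine (measure_mono hsub).trans <|
    (meas_ge_le_variance_div_sq hZ2 (by positivity)).trans (ENNReal.ofReal_le_ofReal ?_)
  calc Var[Z; P] / (m * truncAbsMean / 2) ^ 2 ≤ m / (m * truncAbsMean / 2) ^ 2 := by gcongr
    _ = 4 / (m * truncAbsMean ^ 2) := by field_simp; ring

end Finite

/-- Escape through a mesh; a countable dense subfamily, exhausted by finite ones, detects every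
common zero because `truncAbs` turns vanishing into an open condition. -/
theorem measure_exists_forall_eq_zero_le {κ : Type*} [TopologicalSpace κ]
    [TopologicalSpace.SeparableSpace κ] (hμ : ∫ x, x ∂μ = 0) {u : κ → StrongDual ℝ E}
    (huc : ∀ x, Continuous fun h => u h x) (hu : ∀ i, Var[u i; μ] = 1)
    (hW : Integrable W μ) (huW : ∀ i x, u i x ≤ W x) (hm0 : 0 < m)
    (hm : 64 * (∫ x, W x ∂μ) ^ 2 ≤ truncAbsMean ^ 2 * m) :
    (Measure.pi fun _ : Fin m => μ) {x | ∃ h, ∀ k, u h (x k) = 0} ≤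
      ENNReal.ofReal (4 / (m * truncAbsMean ^ 2)) := by
  have hc := truncAbsMean_pos
  rcases isEmpty_or_nonempty κ with hκ | hκ
  · simp
  set d := TopologicalSpace.denseSeq κ
  set B : ℕ → Set (Fin m → E) := fun N =>
    {x | ∃ i : Fin (N + 1), ∑ k, truncAbs (u (d i) (x k)) ≤ m * truncAbsMean / 4}
  have hmono : Monotone B := by
    rintro N M hNM x ⟨i, hi⟩
    exact ⟨⟨i, by lia⟩, hi⟩
  have hsub : {x : Fin m → E | ∃ h, ∀ k, u h (x k) = 0} ⊆ ⋃ N, B N := by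
    rintro x ⟨h, hx⟩
    have hopen : IsOpen {h | ∑ k, truncAbs (u h (x k)) < m * truncAbsMean / 4} :=
      isOpen_lt (continuous_finsetSum _ fun k _ => continuous_truncAbs.comp (huc (x k)))
        continuous_const
    have hmem : h ∈ {h | ∑ k, truncAbs (u h (x k)) < m * truncAbsMean / 4} := by
      simp only [Set.mem_ofPred_eq, hx, truncAbs, abs_zero, zero_le_one, min_eq_left,
        Finset.sum_const_zero]
      positivity
    obtain ⟨N, hN⟩ := (TopologicalSpace.denseRange_denseSeq κ).exists_mem_open hopen ⟨h, hmem⟩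
    exact Set.mem_iUnion.2 ⟨N, ⟨N, by lia⟩, hN.le⟩
  refine (measure_mono hsub).trans ?_
  rw [hmono.measure_iUnion]
  exact iSup_le fun N => measure_exists_sum_truncAbs_le hμ (fun i => hu _) hW (fun i => huW _)
    hm0 hm

end Escape

section Unitary

variable {n : ℕ}

lemma l1Norm_nonneg (v : Fin n → ℂ) : 0 ≤ l1Norm v := Finset.sum_nonneg fun _ _ => norm_nonneg _

lemma l1Norm_smul (c : ℂ) (v : Fin n → ℂ) : l1Norm (c • v) = ‖c‖ * l1Norm v := by
  simp [l1Norm, Finset.mul_sum]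

lemma norm_dotProduct_le (p d : Fin n → ℂ) : ‖p ⬝ᵥ d‖ ≤ ‖p‖ * l1Norm d := by
  rw [dotProduct, l1Norm, Finset.mul_sum]
  refine (norm_sum_le _ _).trans (Finset.sum_le_sum fun j _ => ?_)
  rw [norm_mul]
  exact mul_le_mul_of_nonneg_right (norm_le_pi_norm p j) (norm_nonneg _)

lemma norm_toLp_sq_le (v : Fin n → ℂ) : ‖WithLp.toLp 2 v‖ ^ 2 ≤ ‖v‖ * l1Norm v := by
  rw [EuclideanSpace.norm_sq_eq, l1Norm, Finset.mul_sum]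
  refine Finset.sum_le_sum fun i _ => ?_
  rw [sq]
  exact mul_le_mul_of_nonneg_right (norm_le_pi_norm v i) (norm_nonneg _)

lemma norm_toLp_mulVec {U : Matrix (Fin n) (Fin n) ℂ} (hU : U ∈ unitaryGroup (Fin n) ℂ)
    (h : Fin n → ℂ) : ‖WithLp.toLp 2 (U *ᵥ h)‖ = ‖WithLp.toLp 2 h‖ :=
  ContinuousLinearMap.norm_map_of_mem_unitary
    (Unitary.map_mem (toEuclideanCLM (n := Fin n) (𝕜 := ℂ)) hU) (WithLp.toLp 2 h)

lemma vecMul_conjTranspose_dotProduct_mulVec {U : Matrix (Fin n) (Fin n) ℂ}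
    (hU : U ∈ unitaryGroup (Fin n) ℂ) (q h : Fin n → ℂ) : (q ᵥ* Uᴴ) ⬝ᵥ (U *ᵥ h) = q ⬝ᵥ h := by
  rw [← dotProduct_mulVec, mulVec_mulVec, ← star_eq_conjTranspose, mem_unitaryGroup_iff'.1 hU,
    one_mulVec]

/-- `U` is unbiased to the standard basis: it is unitary and all its entries have the same
modulus. This is the property of the Fourier matrix behind the uncertainty principle. -/
structure IsUnbiased (U : Matrix (Fin n) (Fin n) ℂ) : Prop where
  mem_unitaryGroup : U ∈ unitaryGroup (Fin n) ℂ
  norm_apply : ∀ i j, ‖U i j‖ = (√n)⁻¹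

lemma isUnbiased_dft : IsUnbiased (dft n) := by
  rcases eq_or_ne n 0 with rfl | hn
  · exact ⟨mem_unitaryGroup_iff.2 (Subsingleton.elim _ _), fun i => i.elim0⟩
  set ζ := Complex.exp (-(2 * (Real.pi : ℂ) * Complex.I) / (n : ℂ)) with hζ
  have hprim : IsPrimitiveRoot ζ n := by
    have h := (Complex.isPrimitiveRoot_exp n hn).inv
    rwa [← Complex.exp_neg, ← neg_div] at h
  have hζ0 : ζ ≠ 0 := Complex.exp_ne_zero _
  have hnorm : ‖ζ‖ = 1 := hprim.norm'_eq_one hn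
  have hstar : star ζ = ζ⁻¹ := (Complex.inv_eq_conj hnorm).symm
  have hsqrt : ((√(n : ℝ) : ℝ) : ℂ) * ((√(n : ℝ) : ℝ) : ℂ) = n := by
    rw [← Complex.ofReal_mul, Real.mul_self_sqrt n.cast_nonneg, Complex.ofReal_natCast]
  refine ⟨mem_unitaryGroup_iff'.2 ?_, fun i j => by simp [dft, ← hζ, hnorm, abs_of_nonneg]⟩
  ext j k
  have hterm (i : Fin n) : star (dft n) j i * dft n i k =
      (ζ ^ (k : ℕ) / ζ ^ (j : ℕ)) ^ (i : ℕ) / n := by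
    simp only [star_apply, dft, ← hζ, star_div₀, star_pow, hstar]
    rw [show star ((√(n : ℝ) : ℝ) : ℂ) = ((√(n : ℝ) : ℝ) : ℂ) from Complex.conj_ofReal _,
      div_mul_div_comm, hsqrt, div_pow, ← pow_mul, ← pow_mul, inv_pow, mul_comm (k : ℕ),
      mul_comm (j : ℕ), inv_mul_eq_div]
  rw [mul_apply, Finset.sum_congr rfl fun i _ => hterm i, ← Finset.sum_div,
    Fin.sum_univ_eq_sum_range (fun i => (ζ ^ (k : ℕ) / ζ ^ (j : ℕ)) ^ i) n]
  rcases eq_or_ne j k with rfl | hjk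
  · simp [div_self (pow_ne_zero _ hζ0), hn]
  · have hne : ζ ^ (k : ℕ) / ζ ^ (j : ℕ) ≠ 1 := fun h =>
      hjk (Fin.ext (hprim.pow_inj j.2 k.2 ((div_eq_one_iff_eq (pow_ne_zero _ hζ0)).1 h).symm))
    rw [geom_sum_eq hne, div_pow, pow_right_comm, pow_right_comm ζ (j : ℕ), hprim.pow_eq_one]
    simp [hjk]

/-- The uncertainty principle in `ℓ₁` form. -/
lemma IsUnbiased.norm_toLp_sq_le {U : Matrix (Fin n) (Fin n) ℂ} (hU : IsUnbiased U)
    (h : Fin n → ℂ) : ‖WithLp.toLp 2 h‖ ^ 2 ≤ (√n)⁻¹ * (l1Norm h * l1Norm (U *ᵥ h)) := by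
  have hsup : ‖U *ᵥ h‖ ≤ (√n)⁻¹ * l1Norm h := by
    refine (pi_norm_le_iff_of_nonneg (by have := l1Norm_nonneg h; positivity)).2 fun i =>
      (norm_dotProduct_le _ h).trans ?_
    refine mul_le_mul_of_nonneg_right ?_ (l1Norm_nonneg h)
    exact (pi_norm_le_iff_of_nonneg (by positivity)).2 fun j => (hU.norm_apply i j).le
  calc ‖WithLp.toLp 2 h‖ ^ 2 = ‖WithLp.toLp 2 (U *ᵥ h)‖ ^ 2 := by
        rw [norm_toLp_mulVec hU.mem_unitaryGroup]
    _ ≤ ‖U *ᵥ h‖ * l1Norm (U *ᵥ h) := JBP.norm_toLp_sq_le _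
    _ ≤ (√n)⁻¹ * l1Norm h * l1Norm (U *ᵥ h) :=
        mul_le_mul_of_nonneg_right hsup (l1Norm_nonneg _)
    _ = _ := mul_assoc _ _ _

lemma IsUnbiased.four_mul_le_cost_sq {U : Matrix (Fin n) (Fin n) ℂ} (hU : IsUnbiased U)
    {lam : ℝ} (hlam : 0 ≤ lam) {h : Fin n → ℂ} (hh : ‖WithLp.toLp 2 h‖ = 1) :
    4 * lam * √n ≤ cost 1 U lam h ^ 2 := by
  have hprod : √n ≤ l1Norm h * l1Norm (U *ᵥ h) := by
    have := mul_le_mul_of_nonneg_left (hU.norm_toLp_sq_le h) (Real.sqrt_nonneg n)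
    rw [hh, one_pow, mul_one, ← mul_assoc] at this
    exact this.trans (mul_le_of_le_one_left
      (mul_nonneg (l1Norm_nonneg _) (l1Norm_nonneg _)) mul_inv_le_one)
  rw [cost, one_mulVec]
  nlinarith [sq_nonneg (l1Norm h - lam * l1Norm (U *ᵥ h)), mul_le_mul_of_nonneg_left hprod hlam]

end Unitary

section Descent

variable {n : ℕ} {U₁ U₂ : Matrix (Fin n) (Fin n) ℂ} {lam : ℝ}

lemma l1Norm_sub_le (a b : Fin n → ℂ) :
    l1Norm (b - a) ≤ l1Norm b - l1Norm a +
      2 * (√(Finset.univ.filter fun i => a i ≠ 0).card * ‖WithLp.toLp 2 (b - a)‖) := by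
  set S := Finset.univ.filter fun i => a i ≠ 0
  have hcauchy : ∑ i ∈ S, ‖(b - a) i‖ ≤ √S.card * ‖WithLp.toLp 2 (b - a)‖ := by
    rw [EuclideanSpace.norm_eq, ← Real.sqrt_mul (Nat.cast_nonneg _)]
    refine Real.le_sqrt_of_sq_le (sq_sum_le_card_mul_sum_sq.trans ?_)
    exact mul_le_mul_of_nonneg_left (Finset.sum_le_sum_of_subset_of_nonneg (Finset.subset_univ _)
      fun _ _ _ => sq_nonneg _) (Nat.cast_nonneg _)
  have hpoint (i : Fin n) :
      ‖(b - a) i‖ ≤ ‖b i‖ - ‖a i‖ + 2 * (if a i ≠ 0 then ‖(b - a) i‖ else 0) := by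
    simp only [Pi.sub_apply]
    split_ifs with h
    · have := norm_sub_norm_le (a i) (b i)
      rw [norm_sub_rev] at this
      linarith
    · simp [not_not.1 h]
  have hsum := Finset.sum_le_sum fun i (_ : i ∈ Finset.univ) => hpoint i
  rw [Finset.sum_add_distrib, Finset.sum_sub_distrib, ← Finset.mul_sum,
    ← Finset.sum_filter] at hsum
  simp only [l1Norm]
  linarith

lemma cost_smul (c : ℂ) (h : Fin n → ℂ) : cost U₁ U₂ lam (c • h) = ‖c‖ * cost U₁ U₂ lam h := by
  simp only [cost, mulVec_smul, l1Norm_smul]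
  ring

lemma cost_sub_le_of_cost_le (hU₁ : U₁ ∈ unitaryGroup (Fin n) ℂ)
    (hU₂ : U₂ ∈ unitaryGroup (Fin n) ℂ) (hlam : 0 ≤ lam) {x y : Fin n → ℂ}
    (hxy : cost U₁ U₂ lam y ≤ cost U₁ U₂ lam x) :
    cost U₁ U₂ lam (y - x) ≤
      2 * (√(supp U₁ x).card + lam * √(supp U₂ x).card) * ‖WithLp.toLp 2 (y - x)‖ := by
  have h₁ := l1Norm_sub_le (U₁ *ᵥ x) (U₁ *ᵥ y)
  have h₂ := l1Norm_sub_le (U₂ *ᵥ x) (U₂ *ᵥ y)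
  rw [← mulVec_sub, norm_toLp_mulVec hU₁] at h₁
  rw [← mulVec_sub, norm_toLp_mulVec hU₂] at h₂
  have := mul_le_mul_of_nonneg_left h₂ hlam
  simp only [cost, supp] at hxy ⊢
  linarith

lemma exists_unit_cost_le_of_not_recovers (hU₁ : U₁ ∈ unitaryGroup (Fin n) ℂ)
    (hU₂ : U₂ ∈ unitaryGroup (Fin n) ℂ) (hlam : 0 ≤ lam) {m : ℕ}
    {A : Matrix (Fin m) (Fin n) ℂ} {x : Fin n → ℂ} (hA : ¬Recovers U₁ U₂ lam A x) :
    ∃ h : Fin n → ℂ, ‖WithLp.toLp 2 h‖ = 1 ∧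
      cost U₁ U₂ lam h ≤ 2 * (√(supp U₁ x).card + lam * √(supp U₂ x).card) ∧ A *ᵥ h = 0 := by
  simp only [Recovers, not_forall, not_lt] at hA
  obtain ⟨y, hAy, hyx, hcost⟩ := hA
  have hpos : 0 < ‖WithLp.toLp 2 (y - x)‖ :=
    norm_pos_iff.2 fun h => hyx (sub_eq_zero.1 (congrArg WithLp.ofLp h))
  set r := ‖WithLp.toLp 2 (y - x)‖
  have hr : ‖((r⁻¹ : ℝ) : ℂ)‖ = r⁻¹ := by
    rw [Complex.norm_real, Real.norm_of_nonneg (by positivity)]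
  refine ⟨((r⁻¹ : ℝ) : ℂ) • (y - x), ?_, ?_, ?_⟩
  · rw [WithLp.toLp_smul, norm_smul, hr, inv_mul_cancel₀ hpos.ne']
  · rw [cost_smul, hr, inv_mul_le_iff₀ hpos, mul_comm r]
    exact cost_sub_le_of_cost_le hU₁ hU₂ hlam hcost
  · rw [mulVec_smul, mulVec_sub, hAy, sub_self, smul_zero]

end Descent

section ComplexGaussian

variable {m n : ℕ} {v : ℝ≥0}

lemma complexGaussian_eq_map (v : ℝ≥0) : complexGaussian v =
    ((gaussianReal 0 (v / 2)).prod (gaussianReal 0 (v / 2))).map Complex.equivRealProdCLM.symm :=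
  rfl

instance : IsGaussian (complexGaussian v) := by
  rw [complexGaussian_eq_map]
  infer_instance

/-- The law of a vector in `ℂⁿ` with i.i.d. complex Gaussian entries of variance `v`, that is, of
a row of the measurement matrix. -/
def gaussianVector (n : ℕ) (v : ℝ≥0) : Measure (Fin n → ℂ) := Measure.pi fun _ => complexGaussian v

instance : IsGaussian (gaussianVector n v) := by
  have h := iIndepFun.hasGaussianLaw (P := gaussianVector n v) (X := fun (i : Fin n) a => a i)
    (fun i => ⟨by
      rw [gaussianVector, (measurePreserving_eval (fun _ => complexGaussian v) i).map_eq]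
      infer_instance⟩)
    (iIndepFun_pi (X := fun _ z => z) fun _ => aemeasurable_id)
  simpa only [Measure.map_id'] using h.isGaussian_map

lemma complexGaussian_map_smul (c : ℝ) :
    (complexGaussian v).map (c • ·) = complexGaussian (‖c‖₊ ^ 2 * v) := by
  have hreal : (gaussianReal 0 (v / 2)).map (c * ·) = gaussianReal 0 (‖c‖₊ ^ 2 * v / 2) := by
    rw [gaussianReal_map_const_mul, mul_zero]
    congr 1
    ext
    simp [mul_div_assoc]
  have hcomm : (fun z : ℂ => c • z) ∘ Complex.equivRealProdCLM.symm =
      Complex.equivRealProdCLM.symm ∘ Prod.map (c * ·) (c * ·) :=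
    funext fun p => (map_smul Complex.equivRealProdCLM.symm c p).symm
  rw [complexGaussian_eq_map, Measure.map_map (by fun_prop) (by fun_prop), hcomm,
    ← Measure.map_map (by fun_prop) (by fun_prop), ← Measure.map_prod_map _ _ (by fun_prop)
    (by fun_prop), hreal, ← complexGaussian_eq_map]

lemma pi_map_smul {ι X : Type*} [Fintype ι] [MeasurableSpace X] [SMul ℝ X]
    [MeasurableConstSMul ℝ X] {μ ν : Measure X} [IsProbabilityMeasure μ] {c : ℝ}
    (h : μ.map (c • ·) = ν) :
    (Measure.pi fun _ : ι => μ).map (c • ·) = Measure.pi fun _ : ι => ν := by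
  have : IsProbabilityMeasure (μ.map (c • ·)) :=
    Measure.isProbabilityMeasure_map (measurable_const_smul c).aemeasurable
  rw [← h]
  exact Measure.pi_map_pi (f := fun _ => (c • ·)) fun _ => (measurable_const_smul c).aemeasurable

lemma gaussianVector_map_smul (c : ℝ) :
    (gaussianVector n v).map (c • ·) = gaussianVector n (‖c‖₊ ^ 2 * v) :=
  pi_map_smul (complexGaussian_map_smul c)

lemma gaussianMatrix_map_smul (c : ℝ) :
    (gaussianMatrix m n v).map (c • ·) = gaussianMatrix m n (‖c‖₊ ^ 2 * v) :=
  pi_map_smul (gaussianVector_map_smul c)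

lemma integral_id_gaussianVector : ∫ a, a ∂gaussianVector n v = 0 := by
  have h := integral_map (μ := gaussianVector n v) (φ := ((-1 : ℝ) • ·)) (f := id)
    (by fun_prop) (by fun_prop)
  rw [gaussianVector_map_smul, nnnorm_neg, nnnorm_one, one_pow, one_mul] at h
  simp only [neg_smul, one_smul, id] at h
  exact self_eq_neg.1 (h.trans (integral_neg _))

/-- The real linear functional `a ↦ Re ∑ⱼ aⱼ hⱼ`. Applied to a row `a` of the measurement matrix `A`
it is the real part of an entry of `A *ᵥ h`. -/
def reDot (h : Fin n → ℂ) : StrongDual ℝ (Fin n → ℂ) :=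
  ∑ j, Complex.reCLM ∘L ((ContinuousLinearMap.mul ℝ ℂ).flip (h j)) ∘L
    ContinuousLinearMap.proj (R := ℝ) (φ := fun _ : Fin n => ℂ) j

lemma reDot_apply (h a : Fin n → ℂ) : reDot h a = (a ⬝ᵥ h).re := by
  simp [reDot, dotProduct, mul_comm]

lemma variance_re_mul_complexGaussian (c : ℂ) :
    Var[fun z => (z * c).re; complexGaussian v] = v / 2 * ‖c‖ ^ 2 := by
  have hid : MemLp (fun x : ℝ => x) 2 (gaussianReal 0 (v / 2)) := memLp_id_gaussianReal 2
  have hsplit : (fun z : ℂ => (z * c).re) ∘ Complex.equivRealProdCLM.symm =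
      fun p => (fun x => c.re * x) p.1 + (fun x => -c.im * x) p.2 := by
    ext p
    simp [Complex.equivRealProdCLM_symm_apply]
    ring
  rw [complexGaussian_eq_map, variance_map (by fun_prop) (by fun_prop), hsplit,
    variance_add_prod (hid.const_mul _) (hid.const_mul _), variance_const_mul, variance_const_mul,
    variance_fun_id_gaussianReal, ← Complex.normSq_eq_norm_sq, Complex.normSq_apply]
  push_cast
  ring

lemma variance_reDot (h : Fin n → ℂ) :
    Var[reDot h; gaussianVector n v] = v / 2 * ‖WithLp.toLp 2 h‖ ^ 2 := by
  have hsum : ⇑(reDot h) = ∑ j, fun a : Fin n → ℂ => (a j * h j).re := by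
    ext a
    simp [reDot_apply, dotProduct]
  rw [hsum, gaussianVector, variance_sum_pi (X := fun j z => (z * h j).re) fun j =>
    IsGaussian.memLp_dual (complexGaussian v)
      (Complex.reCLM ∘L ((ContinuousLinearMap.mul ℝ ℂ).flip (h j))) 2 (by simp)]
  simp only [variance_re_mul_complexGaussian, ← Finset.mul_sum, EuclideanSpace.norm_sq_eq]

end ComplexGaussian

section SoftThreshold

/-- Soft thresholding at level `t`: what remains of `s` after clipping it to `[-t, t]`. It isolates
the rare large values of a Gaussian. -/
def softThreshold (t s : ℝ) : ℝ := s - max (-t) (min s t)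

@[fun_prop]
lemma measurable_softThreshold (t : ℝ) : Measurable (softThreshold t) := by
  unfold softThreshold
  fun_prop

lemma softThreshold_neg {t : ℝ} (ht : 0 ≤ t) (s : ℝ) :
    softThreshold t (-s) = -softThreshold t s := by
  unfold softThreshold
  grind

lemma abs_sub_softThreshold_le {t : ℝ} (ht : 0 ≤ t) (s : ℝ) : |s - softThreshold t s| ≤ t := by
  rw [softThreshold, sub_sub_cancel, abs_le]
  exact ⟨le_max_left _ _, max_le (by linarith) (min_le_right _ _)⟩

lemma abs_softThreshold {t : ℝ} (ht : 0 ≤ t) (s : ℝ) :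
    |softThreshold t s| = max (|s| - t) 0 := by
  unfold softThreshold
  grind

lemma abs_softThreshold_le {t : ℝ} (ht : 0 ≤ t) (s : ℝ) : |softThreshold t s| ≤ |s| := by
  rw [abs_softThreshold ht]
  exact max_le (by linarith) (abs_nonneg s)

lemma softThreshold_sq_mul_exp_le {t : ℝ} (ht : 2 ≤ t) (s : ℝ) :
    softThreshold t s ^ 2 * Real.exp |softThreshold t s| ≤
      2 * Real.exp (-t ^ 2) * (Real.exp (t * s) + Real.exp (-t * s)) := by
  have ht0 : 0 ≤ t := by linarith
  rcases le_total |s| t with hst | hst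
  · have hzero : softThreshold t s = 0 := by
      rw [← abs_eq_zero, abs_softThreshold ht0, max_eq_right (by linarith)]
    rw [hzero, zero_pow two_ne_zero, zero_mul]
    positivity
  have habs : |softThreshold t s| = |s| - t := by
    rw [abs_softThreshold ht0, max_eq_left (by linarith)]
  rw [← sq_abs, habs]
  have hquad := Real.quadratic_le_exp_of_nonneg (by linarith : 0 ≤ |s| - t)
  calc (|s| - t) ^ 2 * Real.exp (|s| - t)
      ≤ 2 * Real.exp (|s| - t) * Real.exp (|s| - t) := by gcongr; linarith
    _ = 2 * Real.exp (2 * (|s| - t)) := by rw [mul_assoc, ← Real.exp_add, ← two_mul (|s| - t)]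
    _ ≤ 2 * Real.exp (-t ^ 2 + |t * s|) := by
        rw [abs_mul, abs_of_nonneg ht0]
        gcongr
        nlinarith
    _ = 2 * Real.exp (-t ^ 2) * Real.exp |t * s| := by rw [Real.exp_add, mul_assoc]
    _ ≤ _ := by
        rw [neg_mul]
        gcongr
        exact Real.exp_abs_le _

lemma exp_le_one_add_add_sq_mul_exp_abs (s : ℝ) :
    Real.exp s ≤ 1 + s + s ^ 2 * Real.exp |s| := by
  have h := Complex.norm_exp_sub_sum_le_norm_mul_exp (s : ℂ) 2
  norm_num [Finset.sum_range_succ] at h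
  norm_cast at h
  linarith [(Real.le_norm_self _).trans h]

lemma integral_gaussianReal_eq_zero_of_odd {v : ℝ≥0} {f : ℝ → ℝ} (hf : ∀ s, f (-s) = -f s) :
    ∫ s, f s ∂gaussianReal 0 v = 0 := by
  have h : ∫ s, f s ∂(gaussianReal 0 v).map (-·) = ∫ s, f (-s) ∂gaussianReal 0 v :=
    (Homeomorph.neg ℝ).measurableEmbedding.integral_map f
  rw [gaussianReal_map_neg, neg_zero] at h
  simp only [hf, integral_neg] at h
  exact self_eq_neg.1 h

lemma integrable_exp_mul_softThreshold {t : ℝ} (ht : 0 ≤ t) (a : ℝ) :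
    Integrable (fun s => Real.exp (a * softThreshold t s)) (gaussianReal 0 1) := by
  refine Integrable.mono' ((integrable_exp_mul_gaussianReal a).add
    (integrable_exp_mul_gaussianReal (-a))) (by fun_prop) (.of_forall fun s => ?_)
  rw [Real.norm_of_nonneg (Real.exp_pos _).le, Pi.add_apply, neg_mul]
  calc Real.exp (a * softThreshold t s) ≤ Real.exp |a * s| := by
        refine Real.exp_le_exp.2 ((le_abs_self _).trans ?_)
        rw [abs_mul, abs_mul]
        exact mul_le_mul_of_nonneg_left (abs_softThreshold_le ht s) (abs_nonneg a)
    _ ≤ _ := Real.exp_abs_le _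

lemma mgf_softThreshold_le {t a : ℝ} (ht : 2 ≤ t) (ha : |a| ≤ 1) :
    mgf (softThreshold t) (gaussianReal 0 1) a ≤
      Real.exp (4 * Real.exp (-(t ^ 2 / 2)) * a ^ 2) := by
  have ht0 : 0 ≤ t := by linarith
  set F : ℝ → ℝ := fun s => Real.exp (t * s) + Real.exp (-t * s)
  have hF : Integrable F (gaussianReal 0 1) :=
    (integrable_exp_mul_gaussianReal t).add (integrable_exp_mul_gaussianReal (-t))
  have hFint : ∫ s, F s ∂gaussianReal 0 1 = 2 * Real.exp (t ^ 2 / 2) := by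
    have hmgf (b : ℝ) : ∫ s, Real.exp (b * s) ∂gaussianReal 0 1 = Real.exp (b ^ 2 / 2) := by
      simpa [mgf] using congrFun (mgf_id_gaussianReal (μ := 0) (v := 1)) b
    rw [integral_add (integrable_exp_mul_gaussianReal t) (integrable_exp_mul_gaussianReal (-t)),
      hmgf, hmgf, neg_sq, two_mul]
  have hS : Integrable (softThreshold t) (gaussianReal 0 1) :=
    ((memLp_id_gaussianReal 1).integrable le_rfl).abs.mono' (by fun_prop)
      (.of_forall fun s => abs_softThreshold_le ht0 s)
  have hlin : Integrable (fun s => 1 + a * softThreshold t s) (gaussianReal 0 1) :=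
    (integrable_const _).add (hS.const_mul a)
  have hpoint (s : ℝ) : Real.exp (a * softThreshold t s) ≤
      1 + a * softThreshold t s + a ^ 2 * (2 * Real.exp (-t ^ 2)) * F s := by
    refine (exp_le_one_add_add_sq_mul_exp_abs _).trans (add_le_add_right ?_ _)
    rw [mul_pow, mul_assoc, mul_assoc]
    refine mul_le_mul_of_nonneg_left (le_trans ?_ (softThreshold_sq_mul_exp_le ht s)) (sq_nonneg a)
    refine mul_le_mul_of_nonneg_left (Real.exp_le_exp.2 ?_) (sq_nonneg _)
    rw [abs_mul]
    exact mul_le_of_le_one_left (abs_nonneg _) ha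
  calc mgf (softThreshold t) (gaussianReal 0 1) a
      ≤ ∫ s, (1 + a * softThreshold t s + a ^ 2 * (2 * Real.exp (-t ^ 2)) * F s)
          ∂gaussianReal 0 1 :=
        integral_mono (integrable_exp_mul_softThreshold ht0 a) (hlin.add (hF.const_mul _)) hpoint
    _ = 1 + a ^ 2 * (2 * Real.exp (-t ^ 2)) * (2 * Real.exp (t ^ 2 / 2)) := by
        rw [integral_add hlin (hF.const_mul _), integral_add (integrable_const _) (hS.const_mul a),
          integral_const_mul, integral_const_mul, hFint,
          integral_gaussianReal_eq_zero_of_odd (softThreshold_neg ht0)]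
        simp
    _ = 4 * Real.exp (-(t ^ 2 / 2)) * a ^ 2 + 1 := by
        rw [show -(t ^ 2 / 2) = -t ^ 2 + t ^ 2 / 2 by ring, Real.exp_add]
        ring
    _ ≤ _ := Real.add_one_le_exp _

/-- Soft thresholding of the real and the imaginary part, which keeps the two parts of a circular
Gaussian independent. -/
def complexSoftThreshold (t : ℝ) (z : ℂ) : ℂ := ⟨softThreshold t z.re, softThreshold t z.im⟩

@[fun_prop]
lemma measurable_complexSoftThreshold (t : ℝ) : Measurable (complexSoftThreshold t) :=
  Complex.measurableEquivRealProd.symm.measurable.comp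
    (.prodMk (by fun_prop : Measurable fun z : ℂ => softThreshold t z.re) (by fun_prop))

lemma norm_sub_complexSoftThreshold_le {t : ℝ} (ht : 0 ≤ t) (z : ℂ) :
    ‖z - complexSoftThreshold t z‖ ≤ 2 * t := by
  refine (Complex.norm_le_abs_re_add_abs_im _).trans ?_
  have hre := abs_sub_softThreshold_le ht z.re
  have him := abs_sub_softThreshold_le ht z.im
  simp only [complexSoftThreshold, Complex.sub_re, Complex.sub_im]
  linarith

lemma exp_re_mul_complexSoftThreshold (t : ℝ) (c : ℂ) (p : ℝ × ℝ) :
    Real.exp (c * complexSoftThreshold t (Complex.equivRealProdCLM.symm p)).re =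
      Real.exp (c.re * softThreshold t p.1) * Real.exp (-c.im * softThreshold t p.2) := by
  rw [← Real.exp_add]
  simp [complexSoftThreshold, Complex.equivRealProdCLM_symm_apply, sub_eq_add_neg]

lemma measurePreserving_equivRealProdCLM_symm :
    MeasurePreserving Complex.equivRealProdCLM.symm
      ((gaussianReal 0 1).prod (gaussianReal 0 1)) (complexGaussian 2) :=
  ⟨by fun_prop, by rw [complexGaussian_eq_map, div_self two_ne_zero]⟩

lemma integrable_exp_re_mul_complexSoftThreshold {t : ℝ} (ht : 0 ≤ t) (c : ℂ) :
    Integrable (fun z => Real.exp (c * complexSoftThreshold t z).re) (complexGaussian 2) := by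
  rw [← measurePreserving_equivRealProdCLM_symm.integrable_comp_emb
    Complex.equivRealProdCLM.symm.toHomeomorph.measurableEmbedding]
  simp only [Function.comp_def, exp_re_mul_complexSoftThreshold]
  exact (integrable_exp_mul_softThreshold ht _).mul_prod (integrable_exp_mul_softThreshold ht _)

lemma integral_exp_re_mul_complexSoftThreshold_le {t : ℝ} (ht : 2 ≤ t) {c : ℂ} (hc : ‖c‖ ≤ 1) :
    ∫ z, Real.exp (c * complexSoftThreshold t z).re ∂complexGaussian 2 ≤
      Real.exp (4 * Real.exp (-(t ^ 2 / 2)) * ‖c‖ ^ 2) := by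
  rw [← measurePreserving_equivRealProdCLM_symm.integral_comp
    Complex.equivRealProdCLM.symm.toHomeomorph.measurableEmbedding]
  simp only [exp_re_mul_complexSoftThreshold]
  rw [integral_prod_mul (fun s => Real.exp (c.re * softThreshold t s))
    fun s => Real.exp (-c.im * softThreshold t s)]
  calc _ ≤ Real.exp (4 * Real.exp (-(t ^ 2 / 2)) * c.re ^ 2) *
        Real.exp (4 * Real.exp (-(t ^ 2 / 2)) * (-c.im) ^ 2) :=
        mul_le_mul (mgf_softThreshold_le ht ((Complex.abs_re_le_norm c).trans hc))
          (mgf_softThreshold_le ht (by rw [abs_neg]; exact (Complex.abs_im_le_norm c).trans hc))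
          mgf_nonneg (Real.exp_pos _).le
    _ = _ := by
        rw [← Real.exp_add, ← Complex.normSq_eq_norm_sq, Complex.normSq_apply]
        ring_nf

variable {n : ℕ} {t : ℝ}

lemma exp_re_dotProduct (c q : Fin n → ℂ) :
    Real.exp (c ⬝ᵥ q).re = ∏ j, Real.exp (c j * q j).re := by
  rw [dotProduct, Complex.re_sum, Real.exp_sum]

lemma integrable_exp_re_dotProduct_complexSoftThreshold (ht : 0 ≤ t) (c : Fin n → ℂ) :
    Integrable (fun g => Real.exp (c ⬝ᵥ (complexSoftThreshold t ∘ g)).re) (gaussianVector n 2) := by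
  simp only [exp_re_dotProduct]
  exact Integrable.fintype_prod (f := fun j z => Real.exp (c j * complexSoftThreshold t z).re)
    fun j => integrable_exp_re_mul_complexSoftThreshold ht _

lemma integral_exp_re_dotProduct_complexSoftThreshold_le (ht : 2 ≤ t) {c : Fin n → ℂ}
    (hc : ∀ j, ‖c j‖ ≤ 1) :
    ∫ g, Real.exp (c ⬝ᵥ (complexSoftThreshold t ∘ g)).re ∂gaussianVector n 2 ≤
      Real.exp (4 * Real.exp (-(t ^ 2 / 2)) * ∑ j, ‖c j‖ ^ 2) := by
  simp only [exp_re_dotProduct, Function.comp_apply]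
  rw [gaussianVector, integral_fintype_prod_eq_prod
    (f := fun j z => Real.exp (c j * complexSoftThreshold t z).re), Finset.mul_sum, Real.exp_sum]
  exact Finset.prod_le_prod (fun j _ => integral_nonneg fun z => (Real.exp_pos _).le)
    fun j _ => integral_exp_re_mul_complexSoftThreshold_le ht (hc j)

end SoftThreshold

section Width

lemma integral_le_log_card_add {Ω ι : Type*} [MeasurableSpace Ω] [Fintype ι] {μ : Measure Ω}
    [IsProbabilityMeasure μ] {f : Ω → ℝ} {Y : ι → Ω → ℝ} {K : ℝ} (hf : Integrable f μ)
    (hfY : ∀ ω, ∃ i, f ω ≤ Y i ω) (hY : ∀ i, Integrable (fun ω => Real.exp (Y i ω)) μ)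
    (hYK : ∀ i, ∫ ω, Real.exp (Y i ω) ∂μ ≤ Real.exp K) :
    ∫ ω, f ω ∂μ ≤ Real.log (Fintype.card ι) + K := by
  have : Nonempty ι :=
    let ⟨ω⟩ := nonempty_of_isProbabilityMeasure μ
    ⟨(hfY ω).choose⟩
  set b := Real.log (Fintype.card ι) + K with hb
  have hexpb : Real.exp b = Fintype.card ι * Real.exp K := by
    rw [hb, Real.exp_add, Real.exp_log (by exact_mod_cast Fintype.card_pos)]
  have hsum : Integrable (fun ω => ∑ i, Real.exp (Y i ω)) μ :=
    integrable_finsetSum _ fun i _ => hY i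
  -- the tangent line of the exponential at `b`
  have htangent (ω : Ω) : f ω ≤ b - 1 + (∑ i, Real.exp (Y i ω)) * Real.exp (-b) := by
    obtain ⟨i, hi⟩ := hfY ω
    have hle := mul_le_mul_of_nonneg_right (Finset.single_le_sum (f := fun i => Real.exp (Y i ω))
      (fun j _ => (Real.exp_pos _).le) (Finset.mem_univ i)) (Real.exp_pos (-b)).le
    rw [← Real.exp_add] at hle
    linarith [Real.add_one_le_exp (Y i ω + -b)]
  calc ∫ ω, f ω ∂μ ≤ ∫ ω, (b - 1 + (∑ i, Real.exp (Y i ω)) * Real.exp (-b)) ∂μ :=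
        integral_mono hf ((integrable_const _).add (hsum.mul_const _)) htangent
    _ = b - 1 + (∑ i, ∫ ω, Real.exp (Y i ω) ∂μ) * Real.exp (-b) := by
        rw [integral_add (integrable_const _) (hsum.mul_const _), integral_mul_const,
          integral_finsetSum _ fun i _ => hY i, integral_const, probReal_univ, one_smul]
    _ ≤ b - 1 + Real.exp b * Real.exp (-b) := by
        gcongr
        rw [hexpb]
        exact (Finset.sum_le_card_nsmul _ _ _ fun i _ => hYK i).trans_eq (by simp)
    _ = b := by rw [← Real.exp_add, add_neg_cancel, Real.exp_zero, sub_add_cancel]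

lemma exists_norm_le_two_mul_re_I_pow_mul (z : ℂ) :
    ∃ i : Fin 4, ‖z‖ ≤ 2 * (Complex.I ^ (i : ℕ) * z).re := by
  by_contra! h
  have h0 := h 0
  have h1 := h 1
  have h2 := h 2
  have h3 := h 3
  simp only [Fin.val_zero, Fin.val_one, Fin.val_two, show ((3 : Fin 4) : ℕ) = 3 from rfl,
    Complex.I_pow_three, pow_zero, one_mul, pow_one, Complex.I_sq, neg_mul, Complex.neg_re,
    Complex.I_mul_re, neg_neg] at h0 h1 h2 h3
  have hre : |z.re| < ‖z‖ / 2 := abs_lt.2 ⟨by linarith, by linarith⟩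
  have him : |z.im| < ‖z‖ / 2 := abs_lt.2 ⟨by linarith, by linarith⟩
  linarith [Complex.norm_le_abs_re_add_abs_im z]

variable {n : ℕ} {U : Matrix (Fin n) (Fin n) ℂ} {t θ lam : ℝ}

lemma exists_norm_vecMul_le_re_dotProduct [NeZero n] (hθ : 0 ≤ θ) (M : Matrix (Fin n) (Fin n) ℂ)
    (q : Fin n → ℂ) : ∃ p : Fin n × Fin 4,
      θ / 2 * ‖q ᵥ* M‖ ≤ (((θ * Complex.I ^ (p.2 : ℕ) : ℂ) • M.col p.1) ⬝ᵥ q).re := by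
  obtain ⟨k, hk⟩ := Finite.exists_max fun k => ‖(q ᵥ* M) k‖
  obtain ⟨i, hi⟩ := exists_norm_le_two_mul_re_I_pow_mul ((q ᵥ* M) k)
  refine ⟨(k, i), ?_⟩
  have hcoord : (q ᵥ* M) k = M.col k ⬝ᵥ q := dotProduct_comm _ _
  rw [smul_dotProduct, smul_eq_mul, ← hcoord, mul_assoc, Complex.re_ofReal_mul]
  calc θ / 2 * ‖q ᵥ* M‖ ≤ θ / 2 * ‖(q ᵥ* M) k‖ := by
        gcongr
        exact (pi_norm_le_iff_of_nonempty _).2 hk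
    _ ≤ θ * (Complex.I ^ (i : ℕ) * (q ᵥ* M) k).re := by
        linarith [mul_le_mul_of_nonneg_left hi hθ]

lemma integrable_complexSoftThreshold_comp (ht : 0 ≤ t) :
    Integrable (fun g => complexSoftThreshold t ∘ g) (gaussianVector n 2) := by
  have hmeas : Measurable fun g : Fin n → ℂ => complexSoftThreshold t ∘ g :=
    measurable_pi_lambda _ fun j => (measurable_complexSoftThreshold t).comp (measurable_pi_apply j)
  have hclip : Integrable (fun g => g - complexSoftThreshold t ∘ g) (gaussianVector n 2) :=
    .of_bound (measurable_id.sub hmeas).aestronglyMeasurable (2 * t) <| .of_forall fun g =>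
      (pi_norm_le_iff_of_nonneg (by positivity)).2 fun j =>
        norm_sub_complexSoftThreshold_le ht (g j)
  have h := IsGaussian.integrable_id.sub hclip
  rwa [show id - (fun g => g - complexSoftThreshold t ∘ g) = _ from funext fun g =>
    sub_sub_cancel g (complexSoftThreshold t ∘ g)] at h

lemma integrable_norm_complexSoftThreshold_comp_vecMul (ht : 0 ≤ t)
    (M : Matrix (Fin n) (Fin n) ℂ) :
    Integrable (fun g => ‖(complexSoftThreshold t ∘ g) ᵥ* M‖) (gaussianVector n 2) :=
  (M.vecMulLinear.toContinuousLinearMap.integrable_comp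
    (integrable_complexSoftThreshold_comp ht)).norm

lemma integral_norm_complexSoftThreshold_comp_vecMul_le (hU : IsUnbiased U) (ht : 2 ≤ t)
    (hθ : 0 < θ) (hθn : θ ≤ √n) :
    θ / 2 * ∫ g, ‖(complexSoftThreshold t ∘ g) ᵥ* Uᴴ‖ ∂gaussianVector n 2 ≤
      Real.log (4 * n) + 4 * Real.exp (-(t ^ 2 / 2)) * θ ^ 2 := by
  have ht0 : 0 ≤ t := by linarith
  have hn : 0 < √(n : ℝ) := hθ.trans_le hθn
  have hn0 : (0 : ℝ) < n := Real.sqrt_pos.1 hn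
  have : NeZero n := ⟨by exact_mod_cast hn0.ne'⟩
  set c : Fin n × Fin 4 → Fin n → ℂ := fun p => (θ * Complex.I ^ (p.2 : ℕ) : ℂ) • Uᴴ.col p.1
  have hcnorm (p j) : ‖c p j‖ = θ / √n := by
    simp [c, hU.norm_apply, abs_of_pos hθ, div_eq_mul_inv]
  have hc1 (p j) : ‖c p j‖ ≤ 1 := by
    rw [hcnorm]
    exact (div_le_one hn).2 hθn
  have hcsum (p) : ∑ j, ‖c p j‖ ^ 2 = θ ^ 2 := by
    simp only [hcnorm, div_pow, Real.sq_sqrt hn0.le, Finset.sum_const, Finset.card_univ,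
      Fintype.card_fin, nsmul_eq_mul]
    field_simp
  have h := integral_le_log_card_add
    ((integrable_norm_complexSoftThreshold_comp_vecMul ht0 Uᴴ).const_mul (θ / 2))
    (fun g => exists_norm_vecMul_le_re_dotProduct hθ.le Uᴴ (complexSoftThreshold t ∘ g))
    (fun p => integrable_exp_re_dotProduct_complexSoftThreshold ht0 (c p))
    (fun p => (integral_exp_re_dotProduct_complexSoftThreshold_le ht (hc1 p)).trans_eq
      (by rw [hcsum]))
  rw [integral_const_mul] at h
  simpa [mul_comm] using h

/-- An upper bound on the dual norm of `cost 1 U lam` at `g`: the part of `g` clipped at level `t`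
is paired with `h`, and what remains is paired with `U *ᵥ h`. -/
def costDualBound (U : Matrix (Fin n) (Fin n) ℂ) (t lam : ℝ) (g : Fin n → ℂ) : ℝ :=
  2 * t + lam⁻¹ * ‖(complexSoftThreshold t ∘ g) ᵥ* Uᴴ‖

lemma costDualBound_nonneg (ht : 0 ≤ t) (hlam : 0 ≤ lam) {g : Fin n → ℂ} :
    0 ≤ costDualBound U t lam g := by
  unfold costDualBound
  positivity

lemma reDot_le_costDualBound_mul_cost (hU : U ∈ unitaryGroup (Fin n) ℂ) (ht : 0 ≤ t)
    (hlam : 0 < lam) (h g : Fin n → ℂ) : reDot h g ≤ costDualBound U t lam g * cost 1 U lam h := by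
  set q := complexSoftThreshold t ∘ g
  have hclip : ‖g - q‖ ≤ 2 * t := (pi_norm_le_iff_of_nonneg (by positivity)).2 fun j =>
    norm_sub_complexSoftThreshold_le ht (g j)
  have h₁ := l1Norm_nonneg h
  have h₂ := l1Norm_nonneg (U *ᵥ h)
  calc reDot h g = ((g - q) ⬝ᵥ h).re + ((q ᵥ* Uᴴ) ⬝ᵥ (U *ᵥ h)).re := by
        rw [vecMul_conjTranspose_dotProduct_mulVec hU, ← Complex.add_re, ← add_dotProduct,
          sub_add_cancel, reDot_apply]
    _ ≤ ‖g - q‖ * l1Norm h + ‖q ᵥ* Uᴴ‖ * l1Norm (U *ᵥ h) :=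
        add_le_add ((Complex.re_le_norm _).trans (norm_dotProduct_le _ _))
          ((Complex.re_le_norm _).trans (norm_dotProduct_le _ _))
    _ ≤ 2 * t * l1Norm h + ‖q ᵥ* Uᴴ‖ * l1Norm (U *ᵥ h) := by gcongr
    _ ≤ 2 * t * l1Norm h + ‖q ᵥ* Uᴴ‖ * l1Norm (U *ᵥ h) +
        (2 * t * lam * l1Norm (U *ᵥ h) + lam⁻¹ * ‖q ᵥ* Uᴴ‖ * l1Norm h) :=
        le_add_of_nonneg_right (by positivity)
    _ = costDualBound U t lam g * cost 1 U lam h := by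
        rw [costDualBound, cost, one_mulVec]
        field_simp
        ring

lemma integrable_costDualBound (ht : 0 ≤ t) :
    Integrable (costDualBound U t lam) (gaussianVector n 2) :=
  (integrable_const _).add
    ((integrable_norm_complexSoftThreshold_comp_vecMul ht Uᴴ).const_mul _)

lemma integral_costDualBound (ht : 0 ≤ t) : ∫ g, costDualBound U t lam g ∂gaussianVector n 2 =
      2 * t + lam⁻¹ * ∫ g, ‖(complexSoftThreshold t ∘ g) ᵥ* Uᴴ‖ ∂gaussianVector n 2 := by
  simp only [costDualBound]
  rw [integral_add (integrable_const _)
    ((integrable_norm_complexSoftThreshold_comp_vecMul ht Uᴴ).const_mul _), integral_const,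
    probReal_univ, one_smul, integral_const_mul]

/-- At clipping level `t = √(8 log log n)` the remainder is sparse enough for `θ = (log n) ^ 2` to
be an admissible exponent, which makes its contribution bounded even after division by `lam`. -/
lemma integral_costDualBound_sq_le (hU : IsUnbiased U) (hlog : 2 ≤ Real.log (Real.log n))
    (hpow : Real.log n ^ 2 ≤ √n) (hlam : (Real.log n)⁻¹ ≤ lam) :
    (∫ g, costDualBound U (√(8 * Real.log (Real.log n))) lam g ∂gaussianVector n 2) ^ 2 ≤
      288 * Real.log (Real.log n) := by
  set L := Real.log n with hL
  set t := √(8 * Real.log L)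
  have hL1 : 1 < L := (Real.log_pos_iff (Real.log_natCast_nonneg n)).1 (by linarith)
  have hL0 : 0 < L := by linarith
  have hn : (n : ℝ) ≠ 0 := by
    rintro h
    simp [hL, h] at hL0
  have ht2 : t ^ 2 = 8 * Real.log L := Real.sq_sqrt (by linarith)
  have ht4 : 4 ≤ t := Real.le_sqrt_of_sq_le (by linarith)
  have hexp : Real.exp (-(t ^ 2 / 2)) * (L ^ 2) ^ 2 = 1 := by
    rw [ht2, show 8 * Real.log L / 2 = (4 : ℕ) * Real.log L by push_cast; ring, Real.exp_neg,
      Real.exp_nat_mul, Real.exp_log hL0]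
    field_simp
  have hlog4 : Real.log (4 * n) ≤ 2 + L := by
    rw [Real.log_mul four_ne_zero hn, show (4 : ℝ) = 2 ^ 2 by norm_num, Real.log_pow]
    push_cast
    linarith [Real.log_two_lt_d9]
  set V := ∫ g, ‖(complexSoftThreshold t ∘ g) ᵥ* Uᴴ‖ ∂gaussianVector n 2
  have hV0 : 0 ≤ V := integral_nonneg fun g => norm_nonneg _
  have hV : L * V ≤ 14 := by
    have hbound := integral_norm_complexSoftThreshold_comp_vecMul_le hU (by linarith : 2 ≤ t)
      (by positivity : 0 < L ^ 2) hpow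
    rw [mul_assoc 4, hexp] at hbound
    refine le_of_mul_le_mul_left (?_ : L * (L * V) ≤ L * 14) hL0
    linarith
  have hlamV : lam⁻¹ * V ≤ 14 :=
    (mul_le_mul_of_nonneg_right (inv_le_of_inv_le₀ hL0 hlam) hV0).trans hV
  have hlam0 : 0 ≤ lam⁻¹ := inv_nonneg.2 ((inv_pos.2 hL0).le.trans hlam)
  rw [integral_costDualBound (by linarith)]
  calc (2 * t + lam⁻¹ * V) ^ 2 ≤ (6 * t) ^ 2 := by
        gcongr
        linarith
    _ = 288 * Real.log L := by rw [mul_pow, ht2]; ring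

end Width

section Recovery

variable {m n : ℕ} {v : ℝ≥0} {U : Matrix (Fin n) (Fin n) ℂ} {lam : ℝ} {x : Fin n → ℂ}

lemma recovers_of_recovers_smul {U₁ U₂ : Matrix (Fin n) (Fin n) ℂ} {c : ℝ}
    {A : Matrix (Fin m) (Fin n) ℂ} (h : Recovers U₁ U₂ lam (c • A) x) :
    Recovers U₁ U₂ lam A x := fun y hy =>
  h y (by rw [smul_mulVec, smul_mulVec, hy])

lemma gaussianMatrix_not_recovers_le_of_pos (U₁ U₂ : Matrix (Fin n) (Fin n) ℂ) (lam : ℝ)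
    (x : Fin n → ℂ) (w : ℝ≥0) (hv : 0 < v) :
    gaussianMatrix m n v {A | ¬Recovers U₁ U₂ lam (Matrix.of A) x} ≤
      gaussianMatrix m n w {A | ¬Recovers U₁ U₂ lam (Matrix.of A) x} := by
  set c := NNReal.sqrt (w / v)
  have hc : ‖(c : ℝ)‖₊ ^ 2 * v = w := by
    rw [NNReal.nnnorm_eq, NNReal.sq_sqrt, div_mul_cancel₀ _ hv.ne']
  have hmap := gaussianMatrix_map_smul (m := m) (n := n) (v := v) c
  rw [hc] at hmap
  rw [← hmap]
  refine le_trans (measure_mono ?_)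
    (Measure.le_map_apply (measurable_const_smul (c : ℝ)).aemeasurable _)
  exact fun A hA h => hA (recovers_of_recovers_smul h)

lemma gaussianMatrix_two_not_recovers_le (hU : IsUnbiased U)
    (hlog : 2 ≤ Real.log (Real.log n)) (hpow : Real.log n ^ 2 ≤ √n) (hlam : (Real.log n)⁻¹ ≤ lam)
    {R : ℝ} (hR : 2 * (√(supp 1 x).card + lam * √(supp U x).card) ≤ R) (hm0 : 0 < m)
    (hm : 18432 * (R ^ 2 * Real.log (Real.log n)) ≤ truncAbsMean ^ 2 * m) :
    gaussianMatrix m n 2 {A | ¬Recovers 1 U lam (Matrix.of A) x} ≤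
      ENNReal.ofReal (4 / (m * truncAbsMean ^ 2)) := by
  have hL : 1 < Real.log n := (Real.log_pos_iff (Real.log_natCast_nonneg n)).1 (by linarith)
  have hlam0 : 0 < lam := (inv_pos.2 (by linarith)).trans_le hlam
  set t := √(8 * Real.log (Real.log n))
  have ht : 0 ≤ t := Real.sqrt_nonneg _
  let κ := {h : Fin n → ℂ // ‖WithLp.toLp 2 h‖ = 1 ∧ cost 1 U lam h ≤ R}
  have hmesh := measure_exists_forall_eq_zero_le (κ := κ) (m := m) (μ := gaussianVector n 2)
    (u := fun h => reDot h.1) (W := fun g => costDualBound U t lam g * R)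
    integral_id_gaussianVector
    (fun a => by
      simp only [reDot_apply]
      exact Complex.continuous_re.comp (continuous_const.dotProduct continuous_subtype_val))
    (fun h => by simp [variance_reDot, h.2.1])
    ((integrable_costDualBound ht).mul_const R)
    (fun h g => (reDot_le_costDualBound_mul_cost hU.mem_unitaryGroup ht hlam0 h.1 g).trans
      (mul_le_mul_of_nonneg_left h.2.2 (costDualBound_nonneg ht hlam0.le)))
    hm0 <| by
      have hwidth := integral_costDualBound_sq_le hU hlog hpow hlam
      rw [integral_mul_const, mul_pow]
      nlinarith [mul_le_mul_of_nonneg_right hwidth (sq_nonneg R)]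
  refine (measure_mono fun A hA => ?_).trans hmesh
  obtain ⟨h, hnorm, hcost, hAh⟩ := exists_unit_cost_le_of_not_recovers
    (one_mem (unitaryGroup (Fin n) ℂ)) hU.mem_unitaryGroup hlam0.le hA
  exact ⟨⟨h, hnorm, hcost.trans hR⟩, fun k =>
    (reDot_apply h (A k)).trans (congrArg Complex.re (congrFun hAh k))⟩

/-- If the descent cone of `x` contains a unit vector at all, the uncertainty principle makes its
radius, and hence `m`, large, so that the escape probability is small; otherwise `x` is always
recovered. -/
theorem gaussianMatrix_not_recovers_le (hU : IsUnbiased U) (hlog : 2 ≤ Real.log (Real.log n))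
    (hpow : Real.log n ^ 2 ≤ √n) (hlam : (Real.log n)⁻¹ ≤ lam)
    (hm : 73728 * ((√(supp 1 x).card + lam * √(supp U x).card) ^ 2 * Real.log (Real.log n)) ≤
      truncAbsMean ^ 2 * m) (hv : 0 < v) :
    gaussianMatrix m n v {A | ¬Recovers 1 U lam (Matrix.of A) x} ≤
      ENNReal.ofReal (4 / Real.log n) := by
  have hL : 0 < Real.log n :=
    zero_lt_one.trans ((Real.log_pos_iff (Real.log_natCast_nonneg n)).1 (by linarith))
  have hlam0 : 0 ≤ lam := (inv_pos.2 hL).le.trans hlam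
  refine (gaussianMatrix_not_recovers_le_of_pos 1 U lam x 2 hv).trans ?_
  set R := 2 * (√(supp 1 x).card + lam * √(supp U x).card) with hR
  have hm' : 18432 * (R ^ 2 * Real.log (Real.log n)) ≤ truncAbsMean ^ 2 * m := by
    refine le_trans (le_of_eq ?_) hm
    rw [hR]
    ring
  by_cases hcone : ∃ h : Fin n → ℂ, ‖WithLp.toLp 2 h‖ = 1 ∧ cost 1 U lam h ≤ R
  · obtain ⟨h, hnorm, hcost⟩ := hcone
    have hcost0 : 0 ≤ cost 1 U lam h :=
      add_nonneg (l1Norm_nonneg _) (mul_nonneg hlam0 (l1Norm_nonneg _))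
    have hLR : Real.log n ≤ R ^ 2 := calc
      Real.log n = (Real.log n)⁻¹ * Real.log n ^ 2 := by field_simp
      _ ≤ lam * √n := mul_le_mul hlam hpow (sq_nonneg _) hlam0
      _ ≤ 4 * lam * √n := by nlinarith [mul_nonneg hlam0 (Real.sqrt_nonneg n)]
      _ ≤ cost 1 U lam h ^ 2 := hU.four_mul_le_cost_sq hlam0 hnorm
      _ ≤ R ^ 2 := by gcongr
    have hLm : Real.log n ≤ m * truncAbsMean ^ 2 := by
      nlinarith [mul_le_mul_of_nonneg_left hlog (sq_nonneg R)]
    have hm0 : 0 < m := Nat.pos_of_ne_zero fun h0 => by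
      simp only [h0, Nat.cast_zero, zero_mul] at hLm
      linarith
    exact (gaussianMatrix_two_not_recovers_le hU hlog hpow hlam hR.ge hm0 hm').trans (by gcongr)
  · have hempty : {A : Fin m → Fin n → ℂ | ¬Recovers 1 U lam (Matrix.of A) x} = ∅ :=
      Set.eq_empty_of_forall_notMem fun A hA =>
        let ⟨h, hnorm, hcost, _⟩ := exists_unit_cost_le_of_not_recovers
          (one_mem (unitaryGroup (Fin n) ℂ)) hU.mem_unitaryGroup hlam0 hA
        hcone ⟨h, hnorm, hcost⟩
    simp [hempty]

lemma add_sq_le_four_mul {a b s : ℝ} (ha : 0 ≤ a) (hb : 0 ≤ b) (has : a ≤ √s) (hbs : b ≤ √s)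
    (hs : 0 ≤ s) : (a + b) ^ 2 ≤ 4 * s := calc
  (a + b) ^ 2 ≤ (√s + √s) ^ 2 := by gcongr
  _ = 4 * s := by linear_combination 4 * Real.sq_sqrt hs

lemma inv_mul_sqrt_le_sqrt {L α s t : ℝ} (hL : 1 ≤ L) (hα : α ≤ 2) (hs : 0 ≤ s)
    (ht : t ≤ s * L ^ α) : L⁻¹ * √t ≤ √s := by
  have hL₀ : 0 < L := zero_lt_one.trans_le hL
  rw [inv_mul_le_iff₀ hL₀, Real.sqrt_le_iff]
  refine ⟨by positivity, ht.trans ?_⟩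
  rw [mul_pow, Real.sq_sqrt hs, mul_comm s, ← Real.rpow_two]
  gcongr

lemma eventually_log_bounds {ε : ℝ} (hε : 0 < ε) : ∀ᶠ n : ℕ in Filter.atTop,
    2 ≤ Real.log (Real.log n) ∧ Real.log n ^ 2 ≤ √n ∧ 4 / Real.log n ≤ ε := by
  have hlog : Filter.Tendsto (fun n : ℕ => Real.log n) Filter.atTop Filter.atTop :=
    Real.tendsto_log_atTop.comp tendsto_natCast_atTop_atTop
  have hpow : ∀ᶠ n : ℕ in Filter.atTop, Real.log n ^ 2 ≤ √n := by
    have h := (Real.isLittleO_pow_log_id_atTop (n := 4)).bound one_pos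
    filter_upwards [tendsto_natCast_atTop_atTop.eventually h] with n hn
    refine Real.le_sqrt_of_sq_le ?_
    simpa [← pow_mul, abs_of_nonneg (Real.log_natCast_nonneg n)] using hn
  filter_upwards [(Real.tendsto_log_atTop.comp hlog).eventually_ge_atTop 2, hpow,
    hlog.eventually_ge_atTop (4 / ε), hlog.eventually_gt_atTop 0] with n h₁ h₂ h₃ h₄
  exact ⟨h₁, h₂, (div_le_comm₀ hε h₄).1 h₃⟩

end Recovery

end JBP

end

theorem theorem1_general :
    ∃ C : ℝ, 0 < C ∧ ∀ ε : ℝ, 0 < ε → ∃ N : ℕ, ∀ n : ℕ, N ≤ n →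
      ∀ U : Matrix (Fin n) (Fin n) ℂ, JBP.IsUnbiased U →
      ∀ (x : Fin n → ℂ) (m : ℕ) (v : ℝ≥0), 0 < v →
        ((JBP.supp 1 x).card ≤ (JBP.supp U x).card →
          C * ((JBP.supp U x).card * Real.log (Real.log n)) ≤ (m : ℝ) →
          JBP.gaussianMatrix m n v
            {A | ¬ JBP.Recovers 1 U 1 (Matrix.of A) x} ≤ ENNReal.ofReal ε) ∧
        ∀ α : ℝ, α ≤ 2 →
          ((JBP.supp U x).card : ℝ) ≤ (JBP.supp 1 x).card * Real.log n ^ α →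
          C * ((JBP.supp 1 x).card * Real.log (Real.log n)) ≤ (m : ℝ) →
          JBP.gaussianMatrix m n v
            {A | ¬ JBP.Recovers 1 U (Real.log n)⁻¹ (Matrix.of A) x} ≤ ENNReal.ofReal ε := by
  have hc : 0 < JBP.truncAbsMean ^ 2 := pow_pos JBP.truncAbsMean_pos 2
  refine ⟨4 * 73728 / JBP.truncAbsMean ^ 2, by positivity, fun ε hε => ?_⟩
  obtain ⟨N, hN⟩ := Filter.eventually_atTop.1 (JBP.eventually_log_bounds hε)
  refine ⟨N, fun n hn U hU x m v hv => ?_⟩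
  obtain ⟨hlog, hpow, hprob⟩ := hN n hn
  have hL : 1 < Real.log n :=
    (Real.log_pos_iff (Real.log_natCast_nonneg n)).1 (by linarith)
  have hrec {lam s : ℝ} (hlam : (Real.log n)⁻¹ ≤ lam)
      (hs : (√(JBP.supp 1 x).card + lam * √(JBP.supp U x).card) ^ 2 ≤ 4 * s)
      (hm : 4 * 73728 / JBP.truncAbsMean ^ 2 * (s * Real.log (Real.log n)) ≤ m) :
      JBP.gaussianMatrix m n v {A | ¬ JBP.Recovers 1 U lam (Matrix.of A) x} ≤ ENNReal.ofReal ε := by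
    refine (JBP.gaussianMatrix_not_recovers_le hU hlog hpow hlam ?_ hv).trans
      (ENNReal.ofReal_le_ofReal hprob)
    rw [div_mul_eq_mul_div, div_le_iff₀ hc] at hm
    nlinarith
  refine ⟨fun hcard => hrec (inv_le_one_of_one_le₀ hL.le) ?_, fun α hα hcard => hrec le_rfl ?_⟩
  · rw [one_mul]
    exact JBP.add_sq_le_four_mul (Real.sqrt_nonneg _) (Real.sqrt_nonneg _)
      (Real.sqrt_le_sqrt (Nat.cast_le.2 hcard)) le_rfl (Nat.cast_nonneg _)
  · exact JBP.add_sq_le_four_mul (Real.sqrt_nonneg _)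
      (mul_nonneg (inv_pos.2 (zero_lt_one.trans hL)).le (Real.sqrt_nonneg _)) le_rfl
      (JBP.inv_mul_sqrt_le_sqrt hL.le hα (Nat.cast_nonneg _) hcard) (Nat.cast_nonneg _)

theorem theorem1 :
    ∃ C : ℝ, 0 < C ∧
      ∀ α : ℝ, 0 ≤ α → α < 1 →
      ∀ ε : ℝ, 0 < ε →
      ∃ N : ℕ, ∀ n : ℕ, N ≤ n →
      ∀ n₁ n₂ : ℕ, n = n₁ * n₂ →
      ∀ (x : Fin n → ℂ) (S₁ S₂ : Finset (Fin n)),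
        S₁ = JBP.supp 1 x → S₂ = JBP.supp (JBP.dft n) x →
        S₁.card ≤ S₂.card →
        (S₁.card : ℝ) ≤ (n : ℝ) / Real.log n →
        JBP.IsPeriodic n₁ S₁ → JBP.IsPeriodic n₂ S₂ →
        (S₂.card : ℝ) ≤ (S₁.card : ℝ) * Real.log n ^ α →
      ∀ (m : ℕ) (v : ℝ≥0), 0 < v →
        ((S₂.card : ℝ) ≤ (S₁.card : ℝ) * Real.log (Real.log n) →
          C * ((S₂.card : ℝ) * Real.log (Real.log n)) ≤ (m : ℝ) →
          JBP.gaussianMatrix m n v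
            {A | ¬ JBP.Recovers 1 (JBP.dft n) 1 (Matrix.of A) x} ≤ ENNReal.ofReal ε) ∧
        ((S₁.card : ℝ) * Real.log (Real.log n) ≤ (S₂.card : ℝ) →
          C * (S₂.card : ℝ) ≤ (m : ℝ) →
          JBP.gaussianMatrix m n v
            {A | ¬ JBP.Recovers 1 (JBP.dft n) (Real.log n)⁻¹ (Matrix.of A) x} ≤ ENNReal.ofReal ε) := by
  obtain ⟨C, hC, h⟩ := theorem1_general
  refine ⟨C, hC, fun α _ hα ε hε => (h ε hε).imp fun N hN => ?_⟩
  rintro n hn - - - x S₁ S₂ rfl rfl hcard - - - hcard_α m v hv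
  obtain ⟨h₁, h₂⟩ := hN n hn (JBP.dft n) JBP.isUnbiased_dft x m v hv
  exact ⟨fun _ => h₁ hcard, fun hlog hm => h₂ α (by linarith) hcard_α
    ((mul_le_mul_of_nonneg_left hlog hC.le).trans hm)⟩
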